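/- For $n\ge 1$ and $1\le i\le n$ put $i^*=n+1-i$, and let $X_{*n}=\{v\in\mathbb Z^n : v(i)+v(i^*)\text{ is independent of } i\}$, let $\mathcal A_n\subset\mathbb R^n$ be the analogous real subspace $X_{*n}\otimes\mathbb R$, let $S_n^*=\{\sigma\in S_n:\sigma(i^*)=\sigma(i)^*\ \forall i\}$, and let $S_n^\circ\subset S_n^*$ be the subgroup of permutations that are even in $S_n$. The roots are $\alpha_{i,j}(x)=x_i-x_j$ for $j\ne i,i^*$; their coroots are $\alpha_{i,j}^\vee=e_i-e_j+e_{j^*}-e_{i^*}$, except that for $n$ odd with middle index $c$ one has $\alpha_{i,c}^\vee=2e_i-2e_{i^*}$ and $\alpha_{c,j}^\vee=2e_{j^*}-2e_j$. Type $D_m$ (split $GO_{2m}$): $n=2m$, Weyl group $W=S_{2m}^\circ$, simple roots $\alpha_{1,2},\dots,\alpha_{m-1,m},\alpha_{m-1,m+1}$, base alcove $\{x\in\mathcal A_{2m}: x_1,\,x_{2m}-1<x_2<\cdots<x_{m-1}<x_m,\,x_{m+1}\}$. Type $B_m$ (split $GO_{2m+1}$): $n=2m+1$, $W=S_{2m+1}^*$,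 simple roots $\alpha_{1,2},\dots,\alpha_{m,m+1}$, base alcove $\{x\in\mathcal A_{2m+1}: x_1,\,x_{2m+1}-1<x_2<\cdots<x_{m+1}\}$. In either case let $\widetilde W=X_{*n}\rtimes W$ be the extended affine Weyl group acting on $\mathcal A_n$ by affine transformations, $t_\nu\in\widetilde W$ the translation by $\nu$, $W_{\mathrm{aff}}\subset\widetilde W$ the affine Weyl group, generated by the reflections across the walls of the base alcove, and $\le$ the Bruhat order on $\widetilde W=W_{\mathrm{aff}}\rtimes\Omega$, where $\Omega$ is the stabilizer of the base alcove ($x\tau\le y\tau'$ iff $\tau=\tau'$ and $x\le y$). For $\mu\in X_{*n}$, $w\in\widetilde W$ is $\mu$-admissible if $w\le t_\lambda$ for some $\lambda\in W\mu$, and $\mu$-permissible if $w\equiv t_\mu$ modulo $W_{\mathrm{aff}}$ and $wv-v\in\operatorname{Conv}(W\mu)$ for all $v$ in the base alcove. Write $\operatorname{Adm}(\mu)$ and $\operatorname{Perm}(\mu)$ for the sets of such elements. A cocharacter is dominant if all simple roots are $\ge 0$ on it, and minuscule if every root takes a value in $\{-1,0,1\}$ on it. Then: 1. In type $D_m$ with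 $m\ge4$ and $3\le q\le m-1$, for $\mu=(2^{(q)},1^{(2m-2q)},0^{(q)})$ one has $\operatorname{Adm}(\mu)\subsetneq\operatorname{Perm}(\mu)$. 2. For example, in type $D_4$ with $\mu=(2^{(3)},1,1,0^{(3)})$, the element $w=t_{(2,1^{(6)},0)}(2\,7)(3\,6)$ is $\mu$-permissible but not $\mu$-admissible. 3. For $m\ge4$, in type $D_m$ the vectors $(1^{(m)},0^{(m)})$ and $(1^{(m-1)},0,1,0^{(m-1)})$ are dominant minuscule cocharacters, their sum is $\mu=(2^{(m-1)},1,1,0^{(m-1)})$, and $\operatorname{Adm}(\mu)\neq\operatorname{Perm}(\mu)$. This is a counterexample to Rapoport's conjecture that admissibility and permissibility are equivalent for every sum of dominant minuscule cocharacters. 4. In type $B_m$ with $m\ge3$ and $3\le q\le m$, for $\mu=(2^{(q)},1^{(2m+1-2q)},0^{(q)})$ one has $\operatorname{Adm}(\mu)\subsetneq\operatorname{Perm}(\mu)$. 5. In type $B_3$, whose root system has rank $3$, with $\mu=(2^{(3)},1,0^{(3)})$, the element $w'=t_{(2,1^{(5)},0)}(2\,6)(3\,5)$ is $\mu$-permissible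 but not $\mu$-admissible. Under the embedding $\iota:(x_1,\dots,x_7)\mapsto(x_1,x_2,x_3,x_4,x_4,x_5,x_6,x_7)$ this $\mu$ is sent to that of part 2, and $w'$ corresponds to the $w$ of part 2: $w\,\iota(x)=\iota(w'x)$ for all $x$. -/

import Mathlib

/-! ## Bruhat order of a group generated by a set of reflections -/

/-- Length of `w` with respect to a set `S` of involutions generating a group that contains `w`. -/
noncomputable def wordLength {G : Type*} [Group G] (S : Set G) (w : G) : ℕ :=
  sInf {k : ℕ | ∃ l : List G, (∀ s ∈ l, s ∈ S) ∧ l.prod = w ∧ l.length = k}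

/-- `t` is conjugate, inside the group generated by `S`, to an element of `S`. -/
def IsConjOfGenerator {G : Type*} [Group G] (S : Set G) (t : G) : Prop :=
  ∃ x ∈ Subgroup.closure S, ∃ s ∈ S, t = x * s * x⁻¹

/-- The Bruhat order on the group generated by `S`: the reflexive and transitive closure of the
relation `x < t x` for `t` a reflection such that `t x` is longer than `x`. -/
def BruhatLE {G : Type*} [Group G] (S : Set G) : G → G → Prop :=
  Relation.ReflTransGen fun x y =>
    ∃ t, IsConjOfGenerator S t ∧ y = t * x ∧ wordLength S x < wordLength S y

/-- The Bruhat order on `⟨S⟩ ⋊ Ω`: `x τ ≤ y τ'` iff `τ = τ'` and `x ≤ y`. -/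
def ExtBruhatLE {G : Type*} [Group G] (S : Set G) (Om : Set G) (w w' : G) : Prop :=
  ∃ x ∈ Subgroup.closure S, ∃ y ∈ Subgroup.closure S, ∃ τ ∈ Om,
    w = x * τ ∧ w' = y * τ ∧ BruhatLE S x y

/-! ## The group `ℤⁿ ⋊ Sₙ` and its affine action on `ℝⁿ` -/

/-- `ℤⁿ ⋊ Sₙ`, where `σ` acts on `ℤⁿ` by `(σ v)(j) = v (σ⁻¹ j)`. -/
abbrev AffPerm (n : ℕ) : Type :=
  (Fin n → Multiplicative ℤ) ⋊[mulAutArrow] Equiv.Perm (Fin n)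

/-- The translation element `t_ν`. -/
def transl {n : ℕ} (v : Fin n → ℤ) : AffPerm n :=
  SemidirectProduct.inl fun j => Multiplicative.ofAdd (v j)

/-- A permutation as an element of `ℤⁿ ⋊ Sₙ`. -/
def permElt {n : ℕ} (σ : Equiv.Perm (Fin n)) : AffPerm n := SemidirectProduct.inr σ

/-- The vector `ν` in `w = t_ν σ`. -/
def translPart {n : ℕ} (w : AffPerm n) : Fin n → ℤ := fun j => (w.left j).toAdd

/-- `w = t_ν σ` sends `x` to `ν + σ x`. -/
def affAct {n : ℕ} (w : AffPerm n) (x : Fin n → ℝ) : Fin n → ℝ :=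
  fun j => (translPart w j : ℝ) + x (w.right⁻¹ j)

/-! ## Cocharacters, roots, coroots, reflections

`Fin n` stands for `{1, …, n}`, so that `Fin.rev` is `i ↦ i* = n + 1 - i`. The case `n = 2m` is the
root datum of split `GO_{2m}` (type `D_m`), the case `n = 2m + 1` that of split `GO_{2m+1}`
(type `B_m`). -/

/-- The cocharacter group `X_* = {v ∈ ℤⁿ | v + v* = (d, …, d) for some d ∈ ℤ}`. -/
def cocharGroup (n : ℕ) : AddSubgroup (Fin n → ℤ) where
  carrier := {v | ∃ d : ℤ, ∀ j, v j + v j.rev = d}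
  zero_mem' := ⟨0, fun _ => by simp⟩
  add_mem' := by
    rintro a b ⟨d, hd⟩ ⟨e, he⟩
    refine ⟨d + e, fun j => ?_⟩
    have h1 := hd j
    have h2 := he j
    simp only [Pi.add_apply]
    linarith
  neg_mem' := by
    rintro a ⟨d, hd⟩
    refine ⟨-d, fun j => ?_⟩
    have h1 := hd j
    simp only [Pi.neg_apply]
    linarith

/-- The apartment `X_* ⊗ ℝ`, as a subspace of `ℝⁿ`. -/
def apartment (n : ℕ) : Set (Fin n → ℝ) := {x | ∃ d : ℝ, ∀ j, x j + x j.rev = d}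

/-- `(i, j)` indexes a root `α_{i,j} : x ↦ x_i - x_j`, that is, `j ≠ i, i*`. -/
def IsRootIndex {n : ℕ} (i j : Fin n) : Prop := j ≠ i ∧ j ≠ i.rev

/-- The coroot `α_{i,j}^∨`; the first two cases occur only for odd `n`, when `j` (resp. `i`) is the
middle index. -/
def corootVec {n : ℕ} (i j : Fin n) : Fin n → ℤ :=
  if j.rev = j then Pi.single i 2 - Pi.single i.rev 2
  else if i.rev = i then Pi.single j.rev 2 - Pi.single j 2
  else Pi.single i 1 - Pi.single j 1 + Pi.single j.rev 1 - Pi.single i.rev 1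

/-- The coroot lattice `Q^∨`. -/
def corootLattice (n : ℕ) : Submodule ℤ (Fin n → ℤ) :=
  Submodule.span ℤ {v | ∃ i j, IsRootIndex i j ∧ v = corootVec i j}

/-- The permutation of the entries by which the linear reflection `s_{i,j}` acts. -/
def reflPerm {n : ℕ} (i j : Fin n) : Equiv.Perm (Fin n) :=
  if j.rev = j then Equiv.swap i i.rev
  else if i.rev = i then Equiv.swap j j.rev
  else Equiv.swap i j * Equiv.swap i.rev j.rev

/-- The reflection `s_{i,j;d}` across the hyperplane `x_i - x_j = d` of the apartment. -/
def affRefl {n : ℕ} (i j : Fin n) (d : ℤ) : AffPerm n :=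
  transl (d • corootVec i j) * permElt (reflPerm i j)

/-- On the apartment, `s_{i,j;d}` is `x ↦ x - (⟨α_{i,j}, x⟩ - d) α_{i,j}^∨`. -/
theorem affAct_affRefl {n : ℕ} {i j : Fin n} (h : IsRootIndex i j) (d : ℤ) {x : Fin n → ℝ}
    (hx : x ∈ apartment n) (k : Fin n) :
    affAct (affRefl i j d) x k = x k - (x i - x j - d) * (corootVec i j k : ℝ) := by
  obtain ⟨c, hc⟩ := hx
  obtain ⟨hji, hjr⟩ := h
  have e1 : affAct (affRefl i j d) x k =
      ((d * corootVec i j k : ℤ) : ℝ) + x ((reflPerm i j)⁻¹ k) := by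
    simp [affAct, affRefl, transl, permElt, translPart, mul_comm]
  have hi := hc i
  have hj := hc j
  have hij : i.rev ≠ j := fun h => hjr h.symm
  have hrr : i.rev ≠ j.rev := fun h => hji (Fin.rev_injective h).symm
  have hirj : i ≠ j.rev := fun h => hjr (by rw [h, Fin.rev_rev])
  rw [e1]
  unfold reflPerm corootVec
  split_ifs with h1 h2
  · rw [h1] at hj
    have hii : i.rev ≠ i := fun h => hji (by
      apply Fin.ext
      have a1 := congrArg Fin.val h
      have a2 := congrArg Fin.val h1
      simp only [Fin.val_rev] at a1 a2
      omega)
    rw [Equiv.swap_inv]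
    by_cases k1 : k = i
    · subst k1
      simp [hii.symm]
      linarith
    by_cases k2 : k = i.rev
    · subst k2
      simp [hii]
      linarith
    · simp [Equiv.swap_apply_of_ne_of_ne k1 k2, k1, k2]
  · rw [h2] at hi
    rw [Equiv.swap_inv]
    by_cases k1 : k = j
    · subst k1
      simp [Ne.symm h1]
      linarith
    by_cases k2 : k = j.rev
    · subst k2
      simp [h1]
      linarith
    · simp [Equiv.swap_apply_of_ne_of_ne k1 k2, k1, k2]
  · rw [mul_inv_rev, Equiv.swap_inv, Equiv.swap_inv, Equiv.Perm.mul_apply]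
    by_cases k1 : k = i
    · subst k1
      rw [Equiv.swap_apply_left, Equiv.swap_apply_of_ne_of_ne hij.symm (Ne.symm h1)]
      simp [hji.symm, hirj, Ne.symm h2]
      ring
    by_cases k2 : k = j
    · subst k2
      rw [Equiv.swap_apply_right, Equiv.swap_apply_of_ne_of_ne (Ne.symm h2) hirj]
      simp [hji, Ne.symm h1, hjr]
      ring
    by_cases k3 : k = i.rev
    · subst k3
      rw [Equiv.swap_apply_of_ne_of_ne h2 hij, Equiv.swap_apply_left]
      simp [h2, hij, hrr]
      linarith
    by_cases k4 : k = j.rev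
    · subst k4
      rw [Equiv.swap_apply_of_ne_of_ne hirj.symm h1, Equiv.swap_apply_right]
      simp [hirj.symm, h1, hrr.symm]
      linarith
    · rw [Equiv.swap_apply_of_ne_of_ne k1 k2, Equiv.swap_apply_of_ne_of_ne k3 k4]
      simp [k1, k2, k3, k4]

/-- `S_n^*`, the permutations with `σ(i*) = σ(i)*`. -/
def signedPerms (n : ℕ) : Subgroup (Equiv.Perm (Fin n)) where
  carrier := {σ | ∀ j, σ j.rev = (σ j).rev}
  one_mem' := fun _ => rfl
  mul_mem' := by
    intro a b ha hb j
    rw [Equiv.Perm.mul_apply, hb, ha, Equiv.Perm.mul_apply]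
  inv_mem' := by
    intro a ha j
    rw [Equiv.Perm.inv_eq_iff_eq, ha, ← Equiv.Perm.mul_apply, mul_inv_cancel, Equiv.Perm.one_apply]

/-- `S_n^∘`, the elements of `S_n^*` that are even in `S_n`. -/
def evenSignedPerms (n : ℕ) : Subgroup (Equiv.Perm (Fin n)) :=
  signedPerms n ⊓ (Equiv.Perm.sign : Equiv.Perm (Fin n) →* ℤˣ).ker

/-! ## Extended affine Weyl group, base alcove, admissible and permissible sets -/

/-- What distinguishes the based root data in question once `n` is fixed: the Weyl group and the
set of (index pairs of) simple roots. -/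
structure WeylData (n : ℕ) where
  weyl : Subgroup (Equiv.Perm (Fin n))
  simple : Set (Fin n × Fin n)

/-- Type `D_m`: Weyl group `S_{2m}^∘`, simple roots
`α_{1,2}, α_{2,3}, …, α_{m-1,m}, α_{m-1,m+1}` (indices start at `0` in `Fin`). -/
def dataD (m : ℕ) : WeylData (2 * m) where
  weyl := evenSignedPerms (2 * m)
  simple := {p | (p.1.val + 1 = p.2.val ∧ p.2.val < m) ∨ (p.1.val + 2 = m ∧ p.2.val = m)}

/-- Type `B_m`: Weyl group `S_{2m+1}^*`, simple roots `α_{1,2}, α_{2,3}, …, α_{m,m+1}`. -/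
def dataB (m : ℕ) : WeylData (2 * m + 1) where
  weyl := signedPerms (2 * m + 1)
  simple := {p | p.1.val + 1 = p.2.val ∧ p.2.val ≤ m}

namespace WeylData

variable {n : ℕ} (R : WeylData n)

/-- The extended affine Weyl group `X_* ⋊ W`. -/
def extAffWeyl : Set (AffPerm n) := {w | translPart w ∈ cocharGroup n ∧ w.right ∈ R.weyl}

/-- The walls `x_i - x_j = d` of the base alcove, which lies in the half spaces `x_i - x_j < d`:
those of the simple roots, and the wall `x_n - x_2 = 1`. -/
def walls : Set (Fin n × Fin n × ℤ) :=
  {p | ((p.1, p.2.1) ∈ R.simple ∧ p.2.2 = 0) ∨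
    (p.1.val + 1 = n ∧ p.2.1.val = 1 ∧ p.2.2 = 1)}

/-- The base alcove: the alcove in the Weyl chamber opposite to the positive one whose closure
contains the origin. In type `D_m` it is given by
`x_1, x_{2m} - 1 < x_2 < ⋯ < x_{m-1} < x_m, x_{m+1}`, in type `B_m` by
`x_1, x_{2m+1} - 1 < x_2 < ⋯ < x_{m+1}`. -/
def alcove : Set (Fin n → ℝ) :=
  {x | x ∈ apartment n ∧ ∀ i j : Fin n, ∀ d : ℤ, (i, j, d) ∈ R.walls → x i - x j < d}

/-- The reflections across the walls of the base alcove. -/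
def simpleRefls : Set (AffPerm n) := {s | ∃ i j d, (i, j, d) ∈ R.walls ∧ s = affRefl i j d}

/-- The affine Weyl group, generated by the reflections across the walls of the base alcove. -/
def affWeyl : Subgroup (AffPerm n) := Subgroup.closure R.simpleRefls

/-- The stabilizer of the base alcove in the extended affine Weyl group. -/
def alcoveStab : Set (AffPerm n) := {τ | τ ∈ R.extAffWeyl ∧ affAct τ '' R.alcove = R.alcove}

/-- The Bruhat order on the extended affine Weyl group determined by the base alcove. -/
def LE : AffPerm n → AffPerm n → Prop := ExtBruhatLE R.simpleRefls R.alcoveStab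

/-- The Weyl group orbit of a vector. -/
def orbit (μ : Fin n → ℤ) : Set (Fin n → ℤ) := {v | ∃ σ ∈ R.weyl, v = fun j => μ (σ⁻¹ j)}

/-- The `μ`-admissible set: all `w` with `w ≤ t_λ` for some `λ ∈ W μ`. -/
def Adm (μ : Fin n → ℤ) : Set (AffPerm n) :=
  {w | w ∈ R.extAffWeyl ∧ ∃ v ∈ R.orbit μ, R.LE w (transl v)}

/-- The `μ`-permissible set: all `w` with `w ≡ t_μ` modulo the affine Weyl group and
`w x - x ∈ Conv(W μ)` for all `x` in the base alcove. -/
def Perm (μ : Fin n → ℤ) : Set (AffPerm n) :=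
  {w | w ∈ R.extAffWeyl ∧ w * (transl μ)⁻¹ ∈ R.affWeyl ∧
    ∀ x ∈ R.alcove, affAct w x - x ∈
      convexHull ℝ ((fun (v : Fin n → ℤ) (j : Fin n) => (v j : ℝ)) '' R.orbit μ)}

/-- `v` is a dominant cocharacter: it lies in the closure of the positive Weyl chamber. -/
def IsDominant (v : Fin n → ℤ) : Prop :=
  v ∈ cocharGroup n ∧ ∀ i j : Fin n, (i, j) ∈ R.simple → 0 ≤ v i - v j

end WeylData

/-- `v` is a minuscule cocharacter: `⟨α, v⟩ ∈ {-1, 0, 1}` for every root `α`. -/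
def IsMinusculeCochar {n : ℕ} (v : Fin n → ℤ) : Prop :=
  v ∈ cocharGroup n ∧ ∀ i j : Fin n, IsRootIndex i j → |v i - v j| ≤ 1

/-! ## The particular cocharacters and the embedding of type `B_m` into type `D_{m+1}` -/

/-- The vector `(2^{(q)}, 1^{(n-2q)}, 0^{(q)})` (for `2q ≤ n`). -/
def muVec (n q : ℕ) : Fin n → ℤ :=
  fun j => if j.val < q then 2 else if j.val + q < n then 1 else 0

/-- `(1^{(m)}, 0^{(m)})`. -/
def spinCochar (m : ℕ) : Fin (2 * m) → ℤ := fun j => if j.val < m then 1 else 0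

/-- `(1^{(m-1)}, 0, 1, 0^{(m-1)})` (for `m ≥ 1`). -/
def spinCochar' (m : ℕ) : Fin (2 * m) → ℤ :=
  fun j => if j.val + 1 < m ∨ j.val = m then 1 else 0

/-- `(x_1, …, x_{2m+1}) ↦ (x_1, …, x_m, x_{m+1}, x_{m+1}, x_{m+2}, …, x_{2m+1})`. -/
def embedBD {A : Type*} (m : ℕ) (x : Fin (2 * m + 1) → A) : Fin (2 * (m + 1)) → A :=
  fun j => if h : j.val ≤ m then x ⟨j.val, by omega⟩ else x ⟨j.val - 1, by omega⟩

/-- `t_{(2,1^{(6)},0)} (2 7)(3 6)`, in type `D_4`. -/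
def exampleD4 : AffPerm (2 * 4) :=
  transl ![2, 1, 1, 1, 1, 1, 1, 0] * permElt (Equiv.swap 1 6 * Equiv.swap 2 5)

/-- `t_{(2,1^{(5)},0)} (2 6)(3 5)`, in type `B_3`. -/
def exampleB3 : AffPerm (2 * 3 + 1) :=
  transl ![2, 1, 1, 1, 1, 1, 0] * permElt (Equiv.swap 1 5 * Equiv.swap 2 4)

/-! Let σ exchange each of the coordinates q-1 and q with its dual, let ν = (2^{(q-2)}, 1, …, 1,
0^{(q-2)}), and put w = t_ν σ. This w is permissible and has the same length as t_μ, but it is not a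
translation; that is what separates the two sets.

Not admissible. All t_λ with λ ∈ Wμ have one length, and a strict step down in the Bruhat order
lowers the length, so an admissible element of that length is itself some t_λ. Length is replaced by
the number of affine roots separating the base alcove A from wA. Only its strict growth along the
Bruhat order is needed (`eq_or_ncard_separating_lt`). The link between word length and sides of
hyperplanes is the strong exchange condition (`exists_shorter_word`). The counts for w and t_μ agree
after grouping ±α_{i,j} with ±α_{i,j*} (`sepCount_flipElt`).

Permissible. At i = q-1, q the displacement wx - x has entry 1 + (x_{i*} - x_i), and 0 < x_{i*} -
x_i < 1 on A, so wx - x is a mixture of μ and its sign flips at these two places. The bound fails at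
the first coordinate, which is why q ≥ 3 is needed. In type D a single flip is odd, but for q < m a
middle pair of entries equal to 1 can be flipped along with it at no cost.

Adm ⊆ Perm holds because Conv(Wμ) is convex and stable under linear reflections: stepping down from
t_λ by reflections keeps every displacement inside it (`sub_mem_of_reflect`).

Types D and B share one argument through `WeylData.IsOrthogonal`; only the verification of those
properties looks at the simple roots. -/

/-! ## Affine roots -/

/-- The value of the affine function `x_i - x_j - d` indexed by `(i, j, d)`. -/
def affVal {n : ℕ} (r : Fin n × Fin n × ℤ) (x : Fin n → ℝ) : ℝ := x r.1 - x r.2.1 - r.2.2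

/-- The action of `ℤⁿ ⋊ Sₙ` on the indices of affine functions. -/
def rootAct {n : ℕ} (g : AffPerm n) (r : Fin n × Fin n × ℤ) : Fin n × Fin n × ℤ :=
  (g.right r.1, g.right r.2.1,
    r.2.2 + translPart g (g.right r.1) - translPart g (g.right r.2.1))

/-- `(i, j, d)` indexes an affine root. -/
def IsAffRoot {n : ℕ} (r : Fin n × Fin n × ℤ) : Prop := IsRootIndex r.1 r.2.1

/-- The reflection in the zero locus of the affine root `r`. -/
def rootRefl {n : ℕ} (r : Fin n × Fin n × ℤ) : AffPerm n := affRefl r.1 r.2.1 r.2.2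

section Basic

variable {n : ℕ}

@[simp] theorem translPart_mul (g h : AffPerm n) (j : Fin n) :
    translPart (g * h) j = translPart g j + translPart h (g.right⁻¹ j) := by
  simp [translPart, mulAutArrow]
  rfl

@[simp] theorem translPart_one (j : Fin n) : translPart (1 : AffPerm n) j = 0 := rfl

@[simp] theorem translPart_transl (v : Fin n → ℤ) : translPart (transl v) = v := rfl

@[simp] theorem transl_right (v : Fin n → ℤ) : (transl v).right = 1 := rfl

@[simp] theorem translPart_permElt (σ : Equiv.Perm (Fin n)) : translPart (permElt σ) = 0 := rfl

@[simp] theorem permElt_right (σ : Equiv.Perm (Fin n)) : (permElt σ).right = σ := rfl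

theorem AffPerm.ext' {g h : AffPerm n} (h1 : ∀ j, translPart g j = translPart h j)
    (h2 : g.right = h.right) : g = h :=
  SemidirectProduct.ext (funext fun j => h1 j) h2

theorem affAct_mul (g h : AffPerm n) (x : Fin n → ℝ) :
    affAct (g * h) x = affAct g (affAct h x) := by
  funext j
  simp [affAct, add_assoc]

@[simp] theorem affAct_one (x : Fin n → ℝ) : affAct 1 x = x := by
  funext j
  simp [affAct]

theorem affVal_rootAct (g : AffPerm n) (r : Fin n × Fin n × ℤ) (x : Fin n → ℝ) :
    affVal (rootAct g r) (affAct g x) = affVal r x := by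
  simp [affVal, rootAct, affAct]
  ring

theorem rootAct_mul (g h : AffPerm n) (r : Fin n × Fin n × ℤ) :
    rootAct (g * h) r = rootAct g (rootAct h r) := by
  simp [rootAct]
  ring

@[simp] theorem rootAct_one (r : Fin n × Fin n × ℤ) : rootAct 1 r = r := by
  simp [rootAct]

@[simp] theorem transl_zero : transl (0 : Fin n → ℤ) = 1 := rfl

theorem transl_add (u v : Fin n → ℤ) : transl (u + v) = transl u * transl v :=
  AffPerm.ext' (fun j => by simp) rfl

theorem transl_neg (v : Fin n → ℤ) : transl (-v) = (transl v)⁻¹ := by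
  rw [eq_inv_iff_mul_eq_one, ← transl_add, neg_add_cancel, transl_zero]

theorem transl_sub (u v : Fin n → ℤ) : transl (u - v) = transl u * (transl v)⁻¹ := by
  rw [sub_eq_add_neg, transl_add, transl_neg]

theorem permElt_mul (σ τ : Equiv.Perm (Fin n)) : permElt (σ * τ) = permElt σ * permElt τ :=
  map_mul _ _ _

theorem permElt_inv (σ : Equiv.Perm (Fin n)) : permElt σ⁻¹ = (permElt σ)⁻¹ :=
  map_inv _ _

/-- The group `X_* ⋊ S_n^*`. -/
def signedAffPerms (n : ℕ) : Subgroup (AffPerm n) where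
  carrier := {g | translPart g ∈ cocharGroup n ∧ g.right ∈ signedPerms n}
  one_mem' := ⟨zero_mem _, one_mem _⟩
  mul_mem' := by
    rintro g h ⟨⟨d, hd⟩, hg⟩ ⟨⟨e, he⟩, hh⟩
    refine ⟨⟨d + e, fun j => ?_⟩, mul_mem hg hh⟩
    have h1 := hd j
    have h2 := he (g.right⁻¹ j)
    have h3 : g.right⁻¹ j.rev = (g.right⁻¹ j).rev := (inv_mem hg : g.right⁻¹ ∈ signedPerms n) j
    rw [translPart_mul, translPart_mul, h3]
    linarith
  inv_mem' := by
    rintro g ⟨⟨d, hd⟩, hg⟩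
    refine ⟨⟨-d, fun j => ?_⟩, inv_mem hg⟩
    have key : ∀ k, translPart g⁻¹ k = -translPart g (g.right k) := by
      intro k
      have := translPart_mul g g⁻¹ (g.right k)
      simp at this
      linarith
    have h1 := hd (g.right j)
    rw [key, key, hg j]
    linarith

theorem affAct_mem_apartment {g : AffPerm n} (hg : g ∈ signedAffPerms n) {x : Fin n → ℝ}
    (hx : x ∈ apartment n) : affAct g x ∈ apartment n := by
  obtain ⟨⟨d, hd⟩, hg⟩ := hg
  obtain ⟨c, hc⟩ := hx
  refine ⟨d + c, fun j => ?_⟩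
  have h3 : g.right⁻¹ j.rev = (g.right⁻¹ j).rev := (inv_mem hg : g.right⁻¹ ∈ signedPerms n) j
  have h1 : ((translPart g j + translPart g j.rev : ℤ) : ℝ) = d := congrArg _ (hd j)
  have h2 := hc (g.right⁻¹ j)
  push_cast at h1
  simp only [affAct, h3]
  linarith

theorem IsAffRoot.rootAct {g : AffPerm n} (hg : g ∈ signedAffPerms n) {r : Fin n × Fin n × ℤ}
    (hr : IsAffRoot r) : IsAffRoot (rootAct g r) := by
  obtain ⟨h1, h2⟩ := hr
  refine ⟨fun h => h1 (g.right.injective h), fun h => h2 (g.right.injective ?_)⟩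
  exact h.trans (hg.2 _).symm

theorem IsRootIndex.symm {i j : Fin n} (h : IsRootIndex i j) : IsRootIndex j i :=
  ⟨h.1.symm, fun e => h.2 (by rw [e, Fin.rev_rev])⟩

theorem IsRootIndex.rev {i j : Fin n} (h : IsRootIndex i j) : IsRootIndex i.rev j.rev :=
  ⟨fun e => h.1 (Fin.rev_injective e), fun e => h.2 (Fin.rev_injective e)⟩

theorem IsRootIndex.rev_right {i j : Fin n} (h : IsRootIndex i j) : IsRootIndex i j.rev :=
  ⟨fun e => h.2 (by rw [← e, Fin.rev_rev]), fun e => h.1 (Fin.rev_injective e)⟩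

theorem rev_eq_self_unique {i j : Fin n} (hi : i.rev = i) (hj : j.rev = j) : i = j := by
  apply Fin.ext
  have a1 := congrArg Fin.val hi
  have a2 := congrArg Fin.val hj
  simp only [Fin.val_rev] at a1 a2
  omega

theorem corootVec_swap {i j : Fin n} (h : IsRootIndex i j) : corootVec j i = -corootVec i j := by
  unfold corootVec
  by_cases hi : i.rev = i
  · have hj : j.rev ≠ j := fun hj => h.1 (rev_eq_self_unique hj hi)
    simp [hi, hj]
  · by_cases hj : j.rev = j
    · simp [hi, hj]
    · simp only [hi, hj, if_false]
      abel

/-- Since x_i + x_{i*} is constant on the apartment, α_{i,j} and α_{j*,i*} are the same function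
there. Every root therefore has two index pairs, and this duality recurs throughout. -/
theorem corootVec_rev {i j : Fin n} (h : IsRootIndex i j) :
    corootVec j.rev i.rev = corootVec i j := by
  unfold corootVec
  by_cases hi : i.rev = i
  · have hj : j.rev ≠ j := fun hj => h.1 (rev_eq_self_unique hj hi)
    simp [hi, hj]
  · by_cases hj : j.rev = j
    · simp [Ne.symm hi, hj]
    · simp only [Ne.symm hi, Ne.symm hj, hi, hj, if_false, Fin.rev_rev]
      abel

theorem reflPerm_swap {i j : Fin n} (h : IsRootIndex i j) : reflPerm j i = reflPerm i j := by
  unfold reflPerm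
  by_cases hi : i.rev = i
  · have hj : j.rev ≠ j := fun hj => h.1 (rev_eq_self_unique hj hi)
    simp [hi, hj]
  · by_cases hj : j.rev = j
    · simp [hi, hj]
    · simp only [hi, hj, if_false, Equiv.swap_comm]

theorem swap_mul_swap_comm {α : Type*} [DecidableEq α] {a b c d : α} (h1 : a ≠ c) (h2 : a ≠ d)
    (h3 : b ≠ c) (h4 : b ≠ d) :
    Equiv.swap a b * Equiv.swap c d = Equiv.swap c d * Equiv.swap a b := by
  rw [Equiv.mul_swap_eq_swap_mul, Equiv.swap_apply_of_ne_of_ne h1.symm h3.symm,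
    Equiv.swap_apply_of_ne_of_ne h2.symm h4.symm]

theorem reflPerm_rev {i j : Fin n} (h : IsRootIndex i j) :
    reflPerm j.rev i.rev = reflPerm i j := by
  unfold reflPerm
  by_cases hi : i.rev = i
  · have hj : j.rev ≠ j := fun hj => h.1 (rev_eq_self_unique hj hi)
    simp [hi, hj, Equiv.swap_comm]
  · by_cases hj : j.rev = j
    · simp [Ne.symm hi, hj, Equiv.swap_comm]
    · simp only [Ne.symm hi, Ne.symm hj, hi, hj, if_false, Fin.rev_rev]
      rw [Equiv.swap_comm j.rev, Equiv.swap_comm j, swap_mul_swap_comm]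
      · exact hi
      · exact fun e => h.2 e.symm
      · exact fun e => h.2 (by rw [← e, Fin.rev_rev])
      · exact hj

theorem affRefl_swap {i j : Fin n} (h : IsRootIndex i j) (d : ℤ) :
    affRefl j i (-d) = affRefl i j d := by
  unfold affRefl
  rw [corootVec_swap h, reflPerm_swap h, neg_smul, smul_neg, neg_neg]

theorem affRefl_rev {i j : Fin n} (h : IsRootIndex i j) (d : ℤ) :
    affRefl j.rev i.rev d = affRefl i j d := by
  unfold affRefl
  rw [corootVec_rev h, reflPerm_rev h]

theorem swap_rev_mem_signedPerms (i : Fin n) : Equiv.swap i i.rev ∈ signedPerms n := by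
  intro j
  by_cases h1 : j = i
  · subst h1
    simp
  by_cases h2 : j = i.rev
  · subst h2
    simp
  rw [Equiv.swap_apply_of_ne_of_ne h1 h2, Equiv.swap_apply_of_ne_of_ne]
  · exact fun e => h2 (by rw [← e, Fin.rev_rev])
  · exact fun e => h1 (Fin.rev_injective e)

theorem reflPerm_mul_self {i j : Fin n} (h : IsRootIndex i j) :
    reflPerm i j * reflPerm i j = 1 := by
  unfold reflPerm
  split_ifs with h1 h2
  · simp
  · simp
  · rw [← mul_assoc, mul_assoc (Equiv.swap i j), ← swap_mul_swap_comm]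
    · simp [← mul_assoc]
    · exact Ne.symm h2
    · exact fun e => h.2 (by rw [e, Fin.rev_rev])
    · exact h.2
    · exact Ne.symm h1

theorem reflPerm_inv {i j : Fin n} (h : IsRootIndex i j) : (reflPerm i j)⁻¹ = reflPerm i j :=
  inv_eq_of_mul_eq_one_left (reflPerm_mul_self h)

theorem reflPerm_mem_signedPerms {i j : Fin n} (h : IsRootIndex i j) :
    reflPerm i j ∈ signedPerms n := by
  unfold reflPerm
  split_ifs with h1 h2
  · exact swap_rev_mem_signedPerms i
  · exact swap_rev_mem_signedPerms j
  · intro k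
    have a1 : i ≠ i.rev := Ne.symm h2
    have a2 : i ≠ j.rev := fun e => h.2 (by rw [e, Fin.rev_rev])
    have a3 : j ≠ i.rev := h.2
    have a4 : j ≠ j.rev := Ne.symm h1
    have a5 : i ≠ j := h.1.symm
    have a6 : i.rev ≠ j.rev := fun e => a5 (Fin.rev_injective e)
    simp only [Equiv.Perm.mul_apply]
    by_cases k1 : k = i
    · subst k1
      simp [Equiv.swap_apply_of_ne_of_ne, *, Ne.symm a2, Ne.symm a4]
    by_cases k2 : k = j
    · subst k2
      simp [Equiv.swap_apply_of_ne_of_ne, *, Ne.symm a3]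
    by_cases k3 : k = i.rev
    · subst k3
      simp [Equiv.swap_apply_of_ne_of_ne, *, Ne.symm a2]
    by_cases k4 : k = j.rev
    · subst k4
      simp [Equiv.swap_apply_of_ne_of_ne, *, Ne.symm a3]
    have b1 : k.rev ≠ i := fun e => k3 (by rw [← e, Fin.rev_rev])
    have b2 : k.rev ≠ j := fun e => k4 (by rw [← e, Fin.rev_rev])
    have b3 : k.rev ≠ i.rev := fun e => k1 (Fin.rev_injective e)
    have b4 : k.rev ≠ j.rev := fun e => k2 (Fin.rev_injective e)
    simp only [Equiv.swap_apply_of_ne_of_ne, *, ne_eq, not_false_eq_true]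

theorem corootVec_mem_cocharGroup (i j : Fin n) : corootVec i j ∈ cocharGroup n := by
  have key : ∀ a b k : Fin n, ∀ z : ℤ,
      (Pi.single a z : Fin n → ℤ) k.rev = (Pi.single a.rev z : Fin n → ℤ) k := by
    intro a b k z
    simp only [Pi.single_apply]
    have : k.rev = a ↔ k = a.rev := ⟨fun e => by rw [← e, Fin.rev_rev], fun e => by
      rw [e, Fin.rev_rev]⟩
    simp only [this]
  refine ⟨0, fun k => ?_⟩
  unfold corootVec
  split_ifs <;> simp only [Pi.add_apply, Pi.sub_apply, key _ i, Fin.rev_rev] <;> ring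

theorem affRefl_mem_signedAffPerms {i j : Fin n} (h : IsRootIndex i j) (d : ℤ) :
    affRefl i j d ∈ signedAffPerms n := by
  refine mul_mem (s := signedAffPerms n) ⟨?_, one_mem _⟩ ⟨zero_mem _, reflPerm_mem_signedPerms h⟩
  exact zsmul_mem (corootVec_mem_cocharGroup i j) d

theorem translPart_affRefl (i j : Fin n) (d : ℤ) (k : Fin n) :
    translPart (affRefl i j d) k = d * corootVec i j k := by
  simp [affRefl]

theorem affRefl_right (i j : Fin n) (d : ℤ) : (affRefl i j d).right = reflPerm i j := by
  simp [affRefl]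

/-- The linear reflection on the apartment. -/
theorem comp_reflPerm {i j : Fin n} (h : IsRootIndex i j) {x : Fin n → ℝ}
    (hx : x ∈ apartment n) (k : Fin n) :
    x (reflPerm i j k) = x k - (x i - x j) * (corootVec i j k : ℝ) := by
  have := affAct_affRefl h 0 hx k
  simp only [affAct, translPart_affRefl, affRefl_right, reflPerm_inv h] at this
  simpa using this

/-- The linear reflection on cocharacters. -/
theorem cochar_comp_reflPerm {i j : Fin n} (h : IsRootIndex i j) {v : Fin n → ℤ}
    (hv : v ∈ cocharGroup n) (k : Fin n) :
    v (reflPerm i j k) = v k - (v i - v j) * corootVec i j k := by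
  obtain ⟨d, hd⟩ := hv
  have := comp_reflPerm h (x := fun k => (v k : ℝ)) ⟨d, fun j => by
    have := hd j
    dsimp only
    exact_mod_cast this⟩ k
  exact_mod_cast this

theorem reflPerm_conj {σ : Equiv.Perm (Fin n)} (hσ : σ ∈ signedPerms n) (i j : Fin n) :
    σ * reflPerm i j * σ⁻¹ = reflPerm (σ i) (σ j) := by
  have e : ∀ k, (σ k).rev = σ k ↔ k.rev = k := fun k => by
    rw [← hσ k]
    exact σ.injective.eq_iff
  have c : ∀ a b, σ * Equiv.swap a b * σ⁻¹ = Equiv.swap (σ a) (σ b) := fun a b => by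
    rw [Equiv.mul_swap_eq_swap_mul, mul_inv_cancel_right]
  unfold reflPerm
  simp only [e]
  simp only [← hσ i, ← hσ j]
  split_ifs
  · exact c _ _
  · exact c _ _
  · rw [← c, ← c]
    group

theorem corootVec_conj {σ : Equiv.Perm (Fin n)} (hσ : σ ∈ signedPerms n) (i j k : Fin n) :
    corootVec i j (σ⁻¹ k) = corootVec (σ i) (σ j) k := by
  have e : ∀ k, (σ k).rev = σ k ↔ k.rev = k := fun k => by
    rw [← hσ k]
    exact σ.injective.eq_iff
  have c : ∀ a : Fin n, ∀ z : ℤ,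
      (Pi.single a z : Fin n → ℤ) (σ⁻¹ k) = (Pi.single (σ a) z : Fin n → ℤ) k := fun a z => by
    simp only [Pi.single_apply, Equiv.Perm.inv_eq_iff_eq]
  unfold corootVec
  simp only [e]
  simp only [← hσ i, ← hσ j]
  split_ifs <;> simp only [Pi.add_apply, Pi.sub_apply, c]

theorem rootRefl_conj {g : AffPerm n} (hg : g ∈ signedAffPerms n) {r : Fin n × Fin n × ℤ}
    (hr : IsAffRoot r) : g * rootRefl r * g⁻¹ = rootRefl (rootAct g r) := by
  rw [mul_inv_eq_iff_eq_mul]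
  obtain ⟨i, j, d⟩ := r
  have h1 := reflPerm_conj hg.2 i j
  have h' : IsRootIndex (g.right i) (g.right j) := hr.rootAct hg
  apply AffPerm.ext'
  · intro k
    have h2 := cochar_comp_reflPerm h' hg.1 k
    have h3 := corootVec_conj hg.2 i j k
    simp only [rootRefl, rootAct, translPart_mul, translPart_affRefl, affRefl_right,
      reflPerm_inv h'] at h2 ⊢
    rw [h2, h3]
    ring
  · simp only [rootRefl, rootAct, SemidirectProduct.mul_right, affRefl_right]
    rw [← h1]
    group

theorem corootVec_pairing {i j : Fin n} (h : IsRootIndex i j) :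
    corootVec i j i - corootVec i j j = 2 := by
  obtain ⟨a, b⟩ := h
  have b'' : i ≠ j.rev := fun e => b (by rw [e, Fin.rev_rev])
  unfold corootVec
  split_ifs with h1 h2
  · have : i ≠ i.rev := fun e => a (rev_eq_self_unique h1 e.symm)
    simp [a, b, this]
  · simp [Ne.symm a, Ne.symm h1, b'']
  · simp [a, b, Ne.symm a, Ne.symm h1, Ne.symm h2, b'']

theorem rootRefl_mul_self {r : Fin n × Fin n × ℤ} (hr : IsAffRoot r) :
    rootRefl r * rootRefl r = 1 := by
  obtain ⟨i, j, d⟩ := r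
  apply AffPerm.ext'
  · intro k
    have h2 := cochar_comp_reflPerm hr (corootVec_mem_cocharGroup i j) k
    have h3 := corootVec_pairing hr
    simp only [rootRefl, translPart_mul, translPart_affRefl, affRefl_right,
      reflPerm_inv hr, h2, h3, translPart_one]
    ring
  · simp only [rootRefl, SemidirectProduct.mul_right, affRefl_right, reflPerm_mul_self hr]
    rfl

theorem rootRefl_inv {r : Fin n × Fin n × ℤ} (hr : IsAffRoot r) :
    (rootRefl r)⁻¹ = rootRefl r :=
  inv_eq_of_mul_eq_one_left (rootRefl_mul_self hr)

theorem affVal_affAct_rootRefl {r r' : Fin n × Fin n × ℤ} (hr : IsAffRoot r) {x : Fin n → ℝ}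
    (hx : x ∈ apartment n) :
    affVal r' (affAct (rootRefl r) x) = affVal r' x -
      affVal r x * (corootVec r.1 r.2.1 r'.1 - corootVec r.1 r.2.1 r'.2.1) := by
  simp only [affVal, rootRefl, affAct_affRefl hr r.2.2 hx]
  ring

theorem affVal_affAct_rootRefl_self {r : Fin n × Fin n × ℤ} (hr : IsAffRoot r) {x : Fin n → ℝ}
    (hx : x ∈ apartment n) : affVal r (affAct (rootRefl r) x) = -affVal r x := by
  have h : ((corootVec r.1 r.2.1 r.1 - corootVec r.1 r.2.1 r.2.1 : ℤ) : ℝ) = (2 : ℤ) :=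
    congrArg _ (corootVec_pairing hr)
  push_cast at h
  rw [affVal_affAct_rootRefl hr hx, h]
  ring

end Basic

/-! ## Based data of orthogonal similitude groups -/

/-- The common features of the data of types `B` and `D`. -/
structure WeylData.IsOrthogonal {n : ℕ} (R : WeylData n) : Prop where
  six_le : 6 ≤ n
  weyl_le : R.weyl ≤ signedPerms n
  reflPerm_mem : ∀ i j, IsRootIndex i j → reflPerm i j ∈ R.weyl
  isRootIndex_of_simple : ∀ p ∈ R.simple, IsRootIndex p.1 p.2 ∧ p.1 < p.2
  sub_mem_Ioo : ∀ x ∈ R.alcove, ∀ i j, IsRootIndex i j → i < j → x i - x j ∈ Set.Ioo (-1 : ℝ) 0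
  -- A simple reflection makes no positive root negative except its own, which appears under its two
  -- index pairs.
  eq_of_lt : ∀ p ∈ R.simple, ∀ i j, IsRootIndex i j → i < j →
    reflPerm p.1 p.2 j < reflPerm p.1 p.2 i → (i, j) = p ∨ (i, j) = (p.2.rev, p.1.rev)
  permElt_mem : ∀ i j, IsRootIndex i j → permElt (reflPerm i j) ∈ R.affWeyl

/-- The affine root `r` is positive on the base alcove. -/
def IsPosRoot {n : ℕ} (r : Fin n × Fin n × ℤ) : Prop := r.2.2 < 0 ∨ (r.2.2 = 0 ∧ r.2.1 < r.1)

/-- A point of the base alcove. -/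
noncomputable def basePoint (n : ℕ) (i : Fin n) : ℝ := i.val / (2 * n)

/-! ### Signs of affine roots on the base alcove and the exchange condition -/

namespace WeylData.IsOrthogonal

variable {n : ℕ} {R : WeylData n}

theorem lt_or_gt {i j : Fin n} (h : IsRootIndex i j) : i < j ∨ j < i := lt_or_gt_of_ne h.1.symm

/-- On the alcove every root takes values in (-1, 0) or (0, 1), so an integer level d ≠ 0 decides
the sign alone, and d = 0 leaves it to the order of the indices. -/
theorem affVal_pos_iff (hR : R.IsOrthogonal) {x : Fin n → ℝ} (hx : x ∈ R.alcove)
    {r : Fin n × Fin n × ℤ} (hr : IsAffRoot r) :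
    (0 < affVal r x ↔ IsPosRoot r) ∧ (affVal r x < 0 ↔ ¬ IsPosRoot r) := by
  obtain ⟨i, j, d⟩ := r
  have key : (IsPosRoot (i, j, d) → 0 < affVal (i, j, d) x) ∧
      (¬ IsPosRoot (i, j, d) → affVal (i, j, d) x < 0) := by
    simp only [IsPosRoot, affVal]
    rcases lt_or_gt hr with h | h
    · obtain ⟨h1, h2⟩ := hR.sub_mem_Ioo x hx i j hr h
      have h' : ¬ j < i := not_lt.2 h.le
      simp only [h', and_false, or_false, not_lt] at *
      constructor <;> intro hd
      · have : (d : ℝ) ≤ -1 := by exact_mod_cast Int.le_sub_one_of_lt hd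
        linarith
      · have : (0 : ℝ) ≤ d := by exact_mod_cast hd
        linarith
    · obtain ⟨h1, h2⟩ := hR.sub_mem_Ioo x hx j i hr.symm h
      simp only [h, and_true] at *
      constructor <;> intro hd
      · have : (d : ℝ) ≤ 0 := by
          have : d ≤ 0 := by omega
          exact_mod_cast this
        linarith
      · have : (1 : ℝ) ≤ d := by
          have : 1 ≤ d := by omega
          exact_mod_cast this
        linarith
  by_cases hp : IsPosRoot (i, j, d)
  · have := key.1 hp
    simp [hp, this, this.le]
  · have := key.2 hp
    simp [hp, this, this.le]

theorem affVal_mul_pos (hR : R.IsOrthogonal) {x y : Fin n → ℝ} (hx : x ∈ R.alcove)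
    (hy : y ∈ R.alcove) {r : Fin n × Fin n × ℤ} (hr : IsAffRoot r) :
    0 < affVal r x * affVal r y := by
  by_cases hp : IsPosRoot r
  · exact mul_pos ((hR.affVal_pos_iff hx hr).1.2 hp) ((hR.affVal_pos_iff hy hr).1.2 hp)
  · exact mul_pos_of_neg_of_neg ((hR.affVal_pos_iff hx hr).2.2 hp)
      ((hR.affVal_pos_iff hy hr).2.2 hp)

theorem isAffRoot_of_wall (hR : R.IsOrthogonal) {r : Fin n × Fin n × ℤ} (hr : r ∈ R.walls) :
    IsAffRoot r := by
  obtain ⟨i, j, d⟩ := r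
  rcases hr with ⟨h, -⟩ | ⟨h1, h2, -⟩
  · exact (hR.isRootIndex_of_simple _ h).1
  · have := hR.six_le
    simp only at h1 h2
    constructor
    · simp only [ne_eq, Fin.ext_iff]
      omega
    · simp only [ne_eq, Fin.ext_iff, Fin.val_rev]
      omega

theorem simpleRefls_subset (hR : R.IsOrthogonal) : R.simpleRefls ⊆ signedAffPerms n := by
  rintro s ⟨i, j, d, h, rfl⟩
  exact affRefl_mem_signedAffPerms (hR.isAffRoot_of_wall h) d

theorem affWeyl_le (hR : R.IsOrthogonal) : R.affWeyl ≤ signedAffPerms n :=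
  (Subgroup.closure_le _).2 hR.simpleRefls_subset

theorem reflPerm_affine_wall (h6 : 6 ≤ n) {a b : Fin n} (ha : a.val + 1 = n) (hb : b.val = 1)
    (i : Fin n) : (reflPerm a b i).val = if i.val = 0 then n - 2 else if i.val = 1 then n - 1
      else if i.val = n - 2 then 0 else if i.val = n - 1 then 1 else i.val := by
  unfold reflPerm
  have h1 : b.rev ≠ b := by
    simp only [ne_eq, Fin.ext_iff, Fin.val_rev]
    omega
  have h2 : a.rev ≠ a := by
    simp only [ne_eq, Fin.ext_iff, Fin.val_rev]
    omega
  simp only [h1, h2, if_false, Equiv.Perm.mul_apply, Equiv.swap_apply_def, Fin.ext_iff,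
    Fin.val_rev, apply_ite Fin.val]
  split_ifs <;> omega

theorem corootVec_affine_wall (h6 : 6 ≤ n) {a b : Fin n} (ha : a.val + 1 = n) (hb : b.val = 1)
    (i : Fin n) : corootVec a b i = if i.val ≤ 1 then -1 else if n - 2 ≤ i.val then 1 else 0 := by
  unfold corootVec
  have h1 : b.rev ≠ b := by
    simp only [ne_eq, Fin.ext_iff, Fin.val_rev]
    omega
  have h2 : a.rev ≠ a := by
    simp only [ne_eq, Fin.ext_iff, Fin.val_rev]
    omega
  simp only [h1, h2, if_false, Pi.add_apply, Pi.sub_apply, Pi.single_apply, Fin.ext_iff,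
    Fin.val_rev]
  split_ifs <;> omega

theorem reflPerm_affine_wall_cases (h6 : 6 ≤ n) {a b : Fin n} (ha : a.val + 1 = n)
    (hb : b.val = 1) (i : Fin n) :
    (i.val = 0 ∧ (reflPerm a b i).val = n - 2 ∧ corootVec a b (reflPerm a b i) = 1) ∨
    (i.val = 1 ∧ (reflPerm a b i).val = n - 1 ∧ corootVec a b (reflPerm a b i) = 1) ∨
    (i.val = n - 2 ∧ (reflPerm a b i).val = 0 ∧ corootVec a b (reflPerm a b i) = -1) ∨
    (i.val = n - 1 ∧ (reflPerm a b i).val = 1 ∧ corootVec a b (reflPerm a b i) = -1) ∨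
    (2 ≤ i.val ∧ i.val < n - 2 ∧ (reflPerm a b i).val = i.val ∧
      corootVec a b (reflPerm a b i) = 0) := by
  have h1 := reflPerm_affine_wall h6 ha hb i
  have h2 := corootVec_affine_wall h6 ha hb (reflPerm a b i)
  have hi := i.isLt
  generalize corootVec a b (reflPerm a b i) = c at *
  generalize reflPerm a b i = k at *
  split_ifs at h1 h2 <;> omega

/-- A wall separates the base alcove only from the alcove adjacent to it. -/
theorem rootRefl_eq_of_isPosRoot (hR : R.IsOrthogonal) {s r : Fin n × Fin n × ℤ}
    (hs : s ∈ R.walls) (hr : IsAffRoot r) (h1 : IsPosRoot r)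
    (h2 : ¬ IsPosRoot (rootAct (rootRefl s) r)) : rootRefl r = rootRefl s := by
  have hsr := hR.isAffRoot_of_wall hs
  obtain ⟨a, b, e⟩ := s
  obtain ⟨i, j, d⟩ := r
  have hr' : IsRootIndex i j := hr
  have h6 := hR.six_le
  rcases hs with ⟨hp, he⟩ | ⟨ha, hb, he⟩
  · simp only at he hp
    subst he
    simp only [IsPosRoot, rootAct, rootRefl, translPart_affRefl, affRefl_right, zero_mul, add_zero,
      sub_zero] at h1 h2
    push Not at h2
    have hd : d = 0 := le_antisymm (by omega) h2.1
    subst hd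
    have hji : j < i := by simpa using h1
    have hlt := lt_of_le_of_ne (h2.2 rfl) fun h => hr'.1 ((reflPerm a b).injective h).symm
    have := hR.eq_of_lt _ hp j i hr'.symm hji hlt
    simp only [rootRefl]
    rw [← affRefl_swap hr', neg_zero]
    rcases this with h | h
    · simp only [Prod.mk.injEq] at h
      rw [h.1, h.2]
    · simp only [Prod.mk.injEq] at h
      rw [h.1, h.2, affRefl_rev hsr]
  · simp only at ha hb he
    subst he
    -- Running through the table of index classes, only the two index pairs of the affine wall,
    -- oriented positively on the alcove, change sign.
    have key : ((i.val = 1 ∧ j.val = n - 1) ∨ (i.val = 0 ∧ j.val = n - 2)) ∧ d = -1 := by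
      have n1 := hr'.1
      have n2 := hr'.2
      have pi := reflPerm_affine_wall_cases h6 ha hb i
      have pj := reflPerm_affine_wall_cases h6 ha hb j
      simp only [IsPosRoot, rootAct, rootRefl, translPart_affRefl, affRefl_right, one_mul,
        ne_eq, Fin.ext_iff, Fin.val_rev, Fin.lt_def] at h1 h2 n1 n2
      generalize (reflPerm a b i) = i' at *
      generalize (reflPerm a b j) = j' at *
      generalize corootVec a b i' = ci at *
      generalize corootVec a b j' = cj at *
      rcases pi with pi | pi | pi | pi | pi <;> rcases pj with pj | pj | pj | pj | pj <;> omega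
    obtain ⟨key, hd⟩ := key
    subst hd
    simp only [rootRefl]
    rcases key with ⟨k1, k2⟩ | ⟨k1, k2⟩
    · have e1 : i = b := Fin.ext (by omega)
      have e2 : j = a := Fin.ext (by omega)
      rw [e1, e2, affRefl_swap hsr]
    · have e1 : i = a.rev := Fin.ext (by rw [Fin.val_rev]; omega)
      have e2 : j = b.rev := Fin.ext (by rw [Fin.val_rev]; omega)
      rw [e1, e2, affRefl_swap (IsRootIndex.rev hsr.symm), affRefl_rev hsr]

/-- A and sA lie on the same side of every hyperplane other than that of s. A change from negative
to positive reduces to the opposite change by applying s to the root. -/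
theorem affVal_rootAct_mul_pos (hR : R.IsOrthogonal) {x : Fin n → ℝ} (hx : x ∈ R.alcove)
    {s r : Fin n × Fin n × ℤ} (hs : s ∈ R.walls) (hr : IsAffRoot r)
    (hne : rootRefl r ≠ rootRefl s) :
    0 < affVal r x * affVal (rootAct (rootRefl s) r) x := by
  have hsr := hR.isAffRoot_of_wall hs
  have hg : rootRefl s ∈ signedAffPerms n := affRefl_mem_signedAffPerms hsr _
  have hr' := hr.rootAct hg
  by_cases h1 : IsPosRoot r <;> by_cases h2 : IsPosRoot (rootAct (rootRefl s) r)
  · exact mul_pos ((hR.affVal_pos_iff hx hr).1.2 h1) ((hR.affVal_pos_iff hx hr').1.2 h2)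
  · exact absurd (hR.rootRefl_eq_of_isPosRoot hs hr h1 h2) hne
  · have := hR.rootRefl_eq_of_isPosRoot hs hr' h2
      (by rwa [← rootAct_mul, rootRefl_mul_self hsr, rootAct_one])
    rw [← rootRefl_conj hg hr, mul_inv_eq_iff_eq_mul, mul_right_inj] at this
    exact absurd this hne
  · exact mul_pos_of_neg_of_neg ((hR.affVal_pos_iff hx hr).2.2 h1)
      ((hR.affVal_pos_iff hx hr').2.2 h2)

/-- The strong exchange condition. -/
theorem exists_shorter_word (hR : R.IsOrthogonal) {x : Fin n → ℝ} (hx : x ∈ R.alcove)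
    (l : List (AffPerm n)) (hl : ∀ s ∈ l, s ∈ R.simpleRefls) :
    ∀ r : Fin n × Fin n × ℤ, IsAffRoot r → affVal r x * affVal r (affAct l.prod x) < 0 →
      ∃ l' : List (AffPerm n), (∀ s ∈ l', s ∈ R.simpleRefls) ∧
        l'.prod = rootRefl r * l.prod ∧ l'.length < l.length := by
  induction l with
  | nil =>
    intro r _ h
    simp only [List.prod_nil, affAct_one] at h
    nlinarith [mul_self_nonneg (affVal r x)]
  | cons s l ih =>
    intro r hr h
    obtain ⟨i, j, d, hs, rfl⟩ := hl s List.mem_cons_self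
    have hl' : ∀ t ∈ l, t ∈ R.simpleRefls := fun t ht => hl t (List.mem_cons_of_mem _ ht)
    have hsr := hR.isAffRoot_of_wall hs
    set s := rootRefl (i, j, d) with hsdef
    have hss : s * s = 1 := rootRefl_mul_self hsr
    have hsg : s ∈ signedAffPerms n := affRefl_mem_signedAffPerms hsr _
    -- If `r` defines the wall of the first letter, deleting that letter gives the shorter word.
    -- Otherwise its hyperplane does not separate A from sA, so the reflected root separates A from
    -- the image under the tail, and induction applies there.
    by_cases hrs : rootRefl r = s
    · refine ⟨l, hl', ?_, by simp⟩
      rw [hrs, List.prod_cons]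
      change _ = s * (s * _)
      rw [← mul_assoc, hss, one_mul]
    · have h1 := hR.affVal_rootAct_mul_pos hx hs hr hrs
      have h2 : affVal r (affAct ((affRefl i j d) :: l).prod x) =
          affVal (rootAct s r) (affAct l.prod x) := by
        rw [List.prod_cons, affAct_mul]
        change affVal r (affAct s _) = _
        have := affVal_rootAct s (rootAct s r) (affAct l.prod x)
        rwa [← rootAct_mul, hss, rootAct_one] at this
      rw [h2] at h
      have h3 : affVal (rootAct s r) x * affVal (rootAct s r) (affAct l.prod x) < 0 := by
        rcases pos_and_pos_or_neg_and_neg_of_mul_pos h1 with ⟨a, b⟩ | ⟨a, b⟩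
        · exact mul_neg_of_pos_of_neg b ((pos_iff_neg_of_mul_neg h).1 a)
        · exact mul_neg_of_neg_of_pos b ((neg_iff_pos_of_mul_neg h).1 a)
      obtain ⟨l', h4, h5, h6⟩ := ih hl' _ (hr.rootAct hsg) h3
      refine ⟨s :: l', ?_, ?_, by simpa using h6⟩
      · intro t ht
        rcases List.mem_cons.1 ht with rfl | ht
        · exact ⟨i, j, d, hs, rfl⟩
        · exact h4 t ht
      · rw [List.prod_cons, List.prod_cons, h5, ← rootRefl_conj hsg hr]
        change _ = rootRefl r * (s * _)
        rw [inv_eq_of_mul_eq_one_left hss]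
        simp only [← mul_assoc, hss, one_mul]

theorem exists_word (hR : R.IsOrthogonal) {w : AffPerm n} (hw : w ∈ R.affWeyl) :
    ∃ l : List (AffPerm n), (∀ s ∈ l, s ∈ R.simpleRefls) ∧ l.prod = w ∧
      l.length = wordLength R.simpleRefls w := by
  have hne : {k : ℕ | ∃ l : List (AffPerm n), (∀ s ∈ l, s ∈ R.simpleRefls) ∧ l.prod = w ∧
      l.length = k}.Nonempty := by
    have hw' : w ∈ (Subgroup.closure R.simpleRefls).toSubmonoid := hw
    rw [Subgroup.closure_toSubmonoid] at hw'
    obtain ⟨l, h1, h2⟩ := Submonoid.exists_list_of_mem_closure hw'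
    refine ⟨_, l, fun s hs => ?_, h2, rfl⟩
    rcases h1 s hs with h | ⟨i, j, d, h, h'⟩
    · exact h
    · refine ⟨i, j, d, h, ?_⟩
      have hinv : (rootRefl (i, j, d))⁻¹ = rootRefl (i, j, d) :=
        rootRefl_inv (hR.isAffRoot_of_wall h)
      rw [← inv_inv s, h']
      exact hinv
  exact Nat.sInf_mem hne

theorem affVal_ne_zero (hR : R.IsOrthogonal) {x : Fin n → ℝ} (hx : x ∈ R.alcove)
    {g : AffPerm n} (hg : g ∈ signedAffPerms n) {r : Fin n × Fin n × ℤ} (hr : IsAffRoot r) :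
    affVal r (affAct g x) ≠ 0 := by
  have h := affVal_rootAct g (rootAct g⁻¹ r) x
  rw [← rootAct_mul, mul_inv_cancel, rootAct_one] at h
  rw [h]
  have := hR.affVal_mul_pos hx hx (hr.rootAct (inv_mem hg))
  exact fun h => by simp [h] at this

/-- A reflection that increases the length is in a hyperplane that does not separate the base
alcove from its image. -/
theorem same_side_of_wordLength_lt (hR : R.IsOrthogonal) {x : Fin n → ℝ} (hx : x ∈ R.alcove)
    {w : AffPerm n} (hw : w ∈ R.affWeyl) {r : Fin n × Fin n × ℤ} (hr : IsAffRoot r)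
    (h : wordLength R.simpleRefls w < wordLength R.simpleRefls (rootRefl r * w)) :
    0 < affVal r x * affVal r (affAct w x) := by
  by_contra hcon
  have h0 : affVal r x * affVal r (affAct w x) ≠ 0 := by
    refine mul_ne_zero ?_ (hR.affVal_ne_zero hx (hR.affWeyl_le hw) hr)
    simpa using hR.affVal_ne_zero hx (one_mem _) hr
  obtain ⟨l, h1, h2, h3⟩ := hR.exists_word hw
  obtain ⟨l', h4, h5, h6⟩ := hR.exists_shorter_word hx l h1 r hr
    (by rw [h2]; exact lt_of_le_of_ne (not_lt.1 hcon) h0)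
  have h7 : wordLength R.simpleRefls (rootRefl r * w) ≤ l'.length :=
    Nat.sInf_le ⟨l', h4, by rw [h5, h2], rfl⟩
  omega

theorem exists_rootRefl_of_isConjOfGenerator (hR : R.IsOrthogonal) {t : AffPerm n}
    (ht : IsConjOfGenerator R.simpleRefls t) :
    ∃ r, IsAffRoot r ∧ t = rootRefl r ∧ t ∈ R.affWeyl := by
  obtain ⟨x, hx, s, hs, rfl⟩ := ht
  have hmem : x * s * x⁻¹ ∈ R.affWeyl :=
    mul_mem (mul_mem hx (Subgroup.subset_closure hs)) (inv_mem hx)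
  obtain ⟨i, j, d, h, rfl⟩ := hs
  have hr := hR.isAffRoot_of_wall h
  have hg := hR.affWeyl_le hx
  have hconj := rootRefl_conj hg hr
  exact ⟨rootAct x (i, j, d), hr.rootAct hg, hconj, hmem⟩

/-- Induction along the Bruhat order, downwards from its larger member. -/
theorem bruhatLE_induction (hR : R.IsOrthogonal) {x y : AffPerm n} (hx : x ∈ R.affWeyl)
    (hxy : BruhatLE R.simpleRefls x y) {P : AffPerm n → Prop} (h0 : P y)
    (step : ∀ z ∈ R.affWeyl, ∀ r, IsAffRoot r →
      (∀ p ∈ R.alcove, 0 < affVal r p * affVal r (affAct z p)) → P (rootRefl r * z) → P z) :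
    P x := by
  refine Relation.ReflTransGen.head_induction_on
    (motive := fun z _ => z ∈ R.affWeyl → P z) hxy (fun _ => h0) ?_ hx
  rintro z u ⟨t, ht, rfl, hlt⟩ - ih hz
  obtain ⟨r, hr, rfl, hmem⟩ := hR.exists_rootRefl_of_isConjOfGenerator ht
  exact step z hz r hr (fun p hp => hR.same_side_of_wordLength_lt hp hz hr hlt)
    (ih (mul_mem hmem hz))

theorem basePoint_mem_apartment : basePoint n ∈ apartment n := by
  refine ⟨(n - 1) / (2 * n), fun j => ?_⟩
  have hj := j.isLt
  simp only [basePoint, Fin.val_rev]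
  rw [← add_div, Nat.cast_sub (by omega)]
  push_cast
  ring_nf

theorem basePoint_mem_alcove (hR : R.IsOrthogonal) : basePoint n ∈ R.alcove := by
  refine ⟨basePoint_mem_apartment, fun i j d h => ?_⟩
  have hn : (0 : ℝ) < 2 * n := by
    have := hR.six_le
    positivity
  simp only [basePoint]
  rw [← sub_div, div_lt_iff₀ hn]
  rcases h with ⟨hp, hd⟩ | ⟨hi, hj, hd⟩
  · have := (hR.isRootIndex_of_simple _ hp).2
    simp only at this hd
    have : (i.val : ℝ) < j.val := by exact_mod_cast this
    simp [hd, this]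
  · simp only at hi hj hd
    have : (i.val : ℝ) + 1 = n := by exact_mod_cast hi
    simp only [hj, hd]
    push_cast
    linarith

end WeylData.IsOrthogonal

/-! ## Translations in the affine Weyl group -/

/-- The translations contained in the affine Weyl group. -/
def WeylData.translLattice {n : ℕ} (R : WeylData n) : AddSubgroup (Fin n → ℤ) where
  carrier := {v | transl v ∈ R.affWeyl}
  zero_mem' := one_mem R.affWeyl
  add_mem' := by
    intro u v hu hv
    rw [Set.mem_ofPred_eq, transl_add]
    exact mul_mem hu hv
  neg_mem' := by
    intro u hu
    rw [Set.mem_ofPred_eq, transl_neg]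
    exact inv_mem hu

namespace WeylData.IsOrthogonal

variable {n : ℕ} {R : WeylData n}

/-- The commutator of t_v with a linear reflection s is the translation by v - s v, which is a
multiple of the coroot. -/
theorem smul_corootVec_mem (hR : R.IsOrthogonal) {v : Fin n → ℤ} (hv : v ∈ R.translLattice)
    {i j : Fin n} (h : IsRootIndex i j) : (v i - v j) • corootVec i j ∈ R.translLattice := by
  have hs := hR.permElt_mem i j h
  have hv' : transl v ∈ R.affWeyl := hv
  have : transl ((v i - v j) • corootVec i j) =
      transl v * (permElt (reflPerm i j) * (transl v)⁻¹ * (permElt (reflPerm i j))⁻¹) := by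
    rw [← mul_assoc, eq_mul_inv_iff_mul_eq, ← mul_assoc, eq_mul_inv_iff_mul_eq]
    apply AffPerm.ext'
    · intro k
      have := cochar_comp_reflPerm h (hR.affWeyl_le hv').1 k
      simp only [translPart_transl] at this
      simp [reflPerm_inv h, this]
    · simp
  change transl _ ∈ R.affWeyl
  rw [this]
  exact mul_mem hv' (mul_mem (mul_mem hs (inv_mem hv')) (inv_mem hs))

theorem corootVec_mem_of_sub (hR : R.IsOrthogonal) {v : Fin n → ℤ} (hv : v ∈ R.translLattice)
    {i j : Fin n} (h : IsRootIndex i j) (h1 : |v i - v j| = 1) :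
    corootVec i j ∈ R.translLattice := by
  have := hR.smul_corootVec_mem hv h
  rcases eq_or_eq_neg_of_abs_eq h1 with e | e <;> rw [e] at this
  · simpa using this
  · simpa using neg_mem this

theorem corootVec_apply {i j : Fin n} (hi : i.rev ≠ i) (hj : j.rev ≠ j) (k : Fin n) :
    corootVec i j k = (if k = i then 1 else 0) - (if k = j then 1 else 0) +
      (if k = j.rev then 1 else 0) - (if k = i.rev then 1 else 0) := by
  simp [corootVec, hi, hj, Pi.single_apply]

/-- The affine wall and its linear reflection yield one coroot, as s_{a,b;1} s_{a,b;0} is a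
translation. From there `corootVec_mem_of_sub` moves to any root pairing to ±1 with a vector already
found. The first coroot is supported on the two outermost positions at each end, whence the division
into outer and inner indices. -/
theorem corootVec_mem (hR : R.IsOrthogonal) {i j : Fin n} (h : IsRootIndex i j) :
    corootVec i j ∈ R.translLattice := by
  have h6 := hR.six_le
  let a : Fin n := ⟨n - 1, by omega⟩
  let b : Fin n := ⟨1, by omega⟩
  let c : Fin n := ⟨2, by omega⟩
  have hw : (a, b, (1 : ℤ)) ∈ R.walls := by
    refine Or.inr ⟨?_, rfl, rfl⟩
    change n - 1 + 1 = n
    omega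
  have hab : IsRootIndex a b := hR.isAffRoot_of_wall hw
  have h0 : corootVec a b ∈ R.translLattice := by
    have h1 : affRefl a b 1 ∈ R.affWeyl := Subgroup.subset_closure ⟨a, b, 1, hw, rfl⟩
    have h2 := mul_mem h1 (inv_mem (hR.permElt_mem a b hab))
    rwa [affRefl, mul_inv_cancel_right, one_smul] at h2
  have outer : ∀ k : Fin n, k.val ≤ 1 ∨ n ≤ k.val + 2 → IsRootIndex k c →
      corootVec k c ∈ R.translLattice := by
    intro k hk hkc
    refine hR.corootVec_mem_of_sub h0 hkc ?_
    have e1 := corootVec_affine_wall h6 (a := a) (b := b) (by simp only [a]; omega) rfl k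
    have e2 := corootVec_affine_wall h6 (a := a) (b := b) (by simp only [a]; omega) rfl c
    simp only [c] at e2
    rw [if_neg (by omega), if_neg (by omega)] at e2
    simp only [c]
    rw [e1, e2]
    split_ifs <;> first | rfl | omega
  have inner : ∀ i j : Fin n, IsRootIndex i j → (i.val ≤ 1 ∨ n ≤ i.val + 2) →
      ¬ (j.val ≤ 1 ∨ n ≤ j.val + 2) → corootVec i j ∈ R.translLattice := by
    intro i j h hi hj
    refine hR.corootVec_mem_of_sub h0 h ?_
    have e1 := corootVec_affine_wall h6 (a := a) (b := b) (by simp only [a]; omega) rfl i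
    have e2 := corootVec_affine_wall h6 (a := a) (b := b) (by simp only [a]; omega) rfl j
    rw [if_neg (by omega), if_neg (by omega)] at e2
    rw [e1, e2]
    split_ifs <;> first | rfl | omega
  have ne_mid : ∀ k : Fin n, k.val ≤ 1 ∨ n ≤ k.val + 2 → k.rev ≠ k := by
    intro k hk
    rw [ne_eq, Fin.ext_iff, Fin.val_rev]
    omega
  -- Two outer indices, or two inner ones, pair to an even number with the first coroot. A detour
  -- through an inner index `c`, respectively the outer index `o`, gives a coroot with pairing ±1.
  by_cases hi : i.val ≤ 1 ∨ n ≤ i.val + 2 <;> by_cases hj : j.val ≤ 1 ∨ n ≤ j.val + 2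
  · have hic : IsRootIndex i c := by
      constructor <;> simp only [ne_eq, Fin.ext_iff, Fin.val_rev, c] <;> omega
    have hcc : c.rev ≠ c := by
      simp only [ne_eq, Fin.ext_iff, Fin.val_rev, c]
      omega
    refine hR.corootVec_mem_of_sub (outer i hi hic) h ?_
    obtain ⟨h1, h2⟩ := h
    rw [corootVec_apply (ne_mid i hi) hcc, corootVec_apply (ne_mid i hi) hcc]
    have n1 := ne_mid i hi
    have : i ≠ c ∧ i ≠ c.rev ∧ j ≠ c ∧ j ≠ c.rev := by
      simp only [ne_eq, Fin.ext_iff, Fin.val_rev, c]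
      omega
    simp [h1, h2, n1.symm, this]
  · exact inner i j h hi hj
  · rw [← neg_neg (corootVec i j), ← corootVec_swap h]
    exact neg_mem (inner j i h.symm hj hi)
  · let o : Fin n := ⟨0, by omega⟩
    by_cases mi : i.rev = i
    · have mj : j.rev ≠ j := fun e => h.1 (rev_eq_self_unique e mi)
      have hoj : IsRootIndex o j := by
        constructor <;> simp only [ne_eq, Fin.ext_iff, Fin.val_rev, o] <;> omega
      refine hR.corootVec_mem_of_sub (inner o j hoj (Or.inl (Nat.zero_le _)) hj) h ?_
      have n1 := ne_mid o (Or.inl (Nat.zero_le _))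
      obtain ⟨h1, h2⟩ := h
      have : i ≠ o ∧ i ≠ o.rev ∧ j ≠ o ∧ j ≠ o.rev := by
        simp only [ne_eq, Fin.ext_iff, Fin.val_rev, o]
        omega
      have h3 : i ≠ j.rev := fun e => h2 (by rw [e, Fin.rev_rev])
      rw [corootVec_apply n1 mj, corootVec_apply n1 mj]
      simp [Ne.symm h1, h3, Ne.symm mj, this]
    · have hoi : IsRootIndex o i := by
        constructor <;> simp only [ne_eq, Fin.ext_iff, Fin.val_rev, o] <;> omega
      refine hR.corootVec_mem_of_sub (inner o i hoi (Or.inl (Nat.zero_le _)) hi) h ?_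
      have n1 := ne_mid o (Or.inl (Nat.zero_le _))
      obtain ⟨h1, h2⟩ := h
      have : i ≠ o ∧ i ≠ o.rev ∧ j ≠ o ∧ j ≠ o.rev := by
        simp only [ne_eq, Fin.ext_iff, Fin.val_rev, o]
        omega
      rw [corootVec_apply n1 mi, corootVec_apply n1 mi]
      simp [h1, h2, Ne.symm mi, this]

/-- The indices in the first half. -/
def firstHalf (n : ℕ) : Finset (Fin n) := Finset.univ.filter fun j => j < j.rev

/-- An antisymmetric vector with even sum over the first half is in the translation lattice. -/
theorem mem_translLattice_of_even (hR : R.IsOrthogonal) {u : Fin n → ℤ}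
    (hu : ∀ j, u j + u j.rev = 0) (he : Even (∑ j ∈ firstHalf n, u j)) :
    u ∈ R.translLattice := by
  have h6 := hR.six_le
  let f : Fin n → Fin n → ℤ := fun j => Pi.single j 1 - Pi.single j.rev 1
  let o : Fin n := ⟨0, by omega⟩
  let b : Fin n := ⟨1, by omega⟩
  have ho : o.rev ≠ o := by
    simp only [ne_eq, Fin.ext_iff, Fin.val_rev, o]
    omega
  have hb : b.rev ≠ b := by
    simp only [ne_eq, Fin.ext_iff, Fin.val_rev, b]
    omega
  have hob : IsRootIndex o b := by
    constructor <;> simp only [ne_eq, Fin.ext_iff, Fin.val_rev, o, b] <;> omega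
  have e1 : ∀ i j : Fin n, i.rev ≠ i → j.rev ≠ j → f i - f j = corootVec i j := by
    intro i j hi hj
    simp only [f, corootVec, hi, hj, if_false]
    abel
  -- This is (f_o - f_b) + (f_o + f_b), a sum of two coroots, because f changes sign under duality.
  have h2 : (2 : ℤ) • f o ∈ R.translLattice := by
    have h3 := hR.corootVec_mem hob
    have h4 := hR.corootVec_mem hob.rev_right
    rw [← e1 _ _ ho hb] at h3
    rw [← e1 _ _ ho (by rwa [Fin.rev_rev, ne_comm])] at h4
    convert add_mem h3 h4 using 1
    simp only [f, Fin.rev_rev]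
    module
  have h1 : ∀ j ∈ firstHalf n, f j - f o ∈ R.translLattice := by
    intro j hj
    simp only [firstHalf, Finset.mem_filter, Finset.mem_univ, true_and] at hj
    by_cases hjo : j = o
    · rw [hjo, sub_self]
      exact zero_mem _
    · rw [e1 _ _ hj.ne' ho]
      refine hR.corootVec_mem ⟨Ne.symm hjo, ?_⟩
      simp only [Fin.lt_def, Fin.ext_iff, Fin.val_rev, o, ne_eq] at hj hjo ⊢
      omega
  have hsum : u = ∑ j ∈ firstHalf n, u j • f j := by
    funext k
    simp only [Finset.sum_apply, Pi.smul_apply, f, Pi.sub_apply, Pi.single_apply, smul_eq_mul,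
      mul_sub, mul_ite, mul_one, mul_zero, Finset.sum_sub_distrib, Finset.sum_ite_eq]
    have : ∀ j : Fin n, (k = j.rev) ↔ (k.rev = j) := fun j =>
      ⟨fun e => by rw [e, Fin.rev_rev], fun e => by rw [← e, Fin.rev_rev]⟩
    simp only [this, Finset.sum_ite_eq, firstHalf, Finset.mem_filter, Finset.mem_univ, true_and,
      Fin.rev_rev]
    have hk := hu k
    rcases lt_trichotomy k k.rev with h | h | h
    · simp [h, h.not_gt]
    · rw [← h] at hk ⊢
      simp
      omega
    · simp [h, h.not_gt]
      omega
  have hsum' : u = ∑ j ∈ firstHalf n, u j • (f j - f o) +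
      (∑ j ∈ firstHalf n, u j) • f o := by
    rw [hsum]
    simp only [smul_sub, Finset.sum_sub_distrib, Finset.sum_smul, ← hsum, sub_add_cancel]
  rw [hsum']
  refine add_mem (sum_mem fun j hj => zsmul_mem (h1 j hj) _) ?_
  obtain ⟨e, he⟩ := he
  rw [he, ← mul_two, mul_smul]
  exact zsmul_mem h2 e

theorem sum_eq_firstHalf {M : Type*} [AddCommMonoid M] (g : Fin n → M)
    (hg : ∀ j, g j.rev = g j) (hm : ∀ j, j.rev = j → g j = 0) :
    ∑ j, g j = ∑ j ∈ firstHalf n, g j + ∑ j ∈ firstHalf n, g j := by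
  have h1 : ∑ j ∈ firstHalf n, g j = ∑ j, if j.rev < j then g j else 0 := by
    rw [firstHalf, Finset.sum_filter, ← Equiv.sum_comp Fin.revPerm]
    simp [hg]
  nth_rw 1 [h1]
  rw [firstHalf, Finset.sum_filter, ← Finset.sum_add_distrib]
  refine Finset.sum_congr rfl fun j _ => ?_
  rcases lt_trichotomy j j.rev with h | h | h
  · simp [h, h.not_gt]
  · simp [← h, hm j h.symm]
  · simp [h, h.not_gt]

/-- The difference is antisymmetric, so only a parity is at stake. Modulo 2 each k equals k², and
the sum of the squares of μ - e is invariant under permutations, hence so is its half over the first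
indices. -/
theorem comp_sub_mem_translLattice (hR : R.IsOrthogonal) {μ : Fin n → ℤ} {e : ℤ}
    (hμ : ∀ j, μ j + μ j.rev = 2 * e) {σ : Equiv.Perm (Fin n)} (hσ : σ ∈ signedPerms n) :
    (fun j => μ (σ j)) - μ ∈ R.translLattice := by
  have hν : ∀ j, μ (σ j) + μ (σ j.rev) = 2 * e := fun j => by rw [hσ j, hμ]
  refine hR.mem_translLattice_of_even (fun j => ?_) ?_
  · have h1 := hμ j
    have h2 := hν j
    simp only [Pi.sub_apply]
    omega
  · have key : ∀ ν : Fin n → ℤ, (∀ j, ν j + ν j.rev = 2 * e) →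
        ∑ j, (ν j - e) ^ 2 = 2 * ∑ j ∈ firstHalf n, (ν j - e) ^ 2 := by
      intro ν hν
      rw [sum_eq_firstHalf, two_mul]
      · intro j
        have : ν j.rev - e = -(ν j - e) := by linarith [hν j]
        rw [this, neg_sq]
      · intro j hj
        have := hν j
        rw [hj] at this
        have : ν j - e = 0 := by linarith
        simp [this]
    have k1 := key μ hμ
    have k2 := key _ hν
    rw [Equiv.sum_comp σ fun j => (μ j - e) ^ 2, k1] at k2
    have h3 : ∑ j ∈ firstHalf n, ((μ (σ j) - e) ^ 2 - (μ j - e) ^ 2) = 0 := by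
      rw [Finset.sum_sub_distrib]
      linarith
    have h4 : Even (∑ j ∈ firstHalf n,
        ((μ (σ j) - μ j) - ((μ (σ j) - e) ^ 2 - (μ j - e) ^ 2))) := by
      refine Finset.even_sum _ fun j _ => ?_
      have : (μ (σ j) - μ j) - ((μ (σ j) - e) ^ 2 - (μ j - e) ^ 2) =
          (μ j - e) * ((μ j - e) - 1) - (μ (σ j) - e) * ((μ (σ j) - e) - 1) := by ring
      rw [this]
      exact (Int.even_mul_pred_self _).sub (Int.even_mul_pred_self _)
    rw [Finset.sum_sub_distrib, h3, sub_zero] at h4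
    exact h4

end WeylData.IsOrthogonal

namespace WeylData

variable {n : ℕ} {R : WeylData n}

/-! ## Admissible elements are permissible -/

theorem comp_mem_orbit {μ v : Fin n → ℤ} (hv : v ∈ R.orbit μ) {σ : Equiv.Perm (Fin n)}
    (hσ : σ ∈ R.weyl) : (fun j => v (σ j)) ∈ R.orbit μ := by
  obtain ⟨ρ, hρ, rfl⟩ := hv
  exact ⟨σ⁻¹ * ρ, mul_mem (inv_mem hσ) hρ, by simp⟩

theorem self_mem_orbit (μ : Fin n → ℤ) : μ ∈ R.orbit μ := ⟨1, one_mem _, by simp⟩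

theorem comp_mem_convexHull {S : Set (Fin n → ℤ)} {σ : Fin n → Fin n}
    (hS : ∀ v ∈ S, (fun j => v (σ j)) ∈ S) {z : Fin n → ℝ}
    (hz : z ∈ convexHull ℝ ((fun (v : Fin n → ℤ) (j : Fin n) => (v j : ℝ)) '' S)) :
    (fun j => z (σ j)) ∈ convexHull ℝ ((fun (v : Fin n → ℤ) (j : Fin n) => (v j : ℝ)) '' S) := by
  have h := convexHull_min (s := (fun (v : Fin n → ℤ) (j : Fin n) => (v j : ℝ)) '' S)
    (t := LinearMap.funLeft ℝ ℝ σ ⁻¹'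
      convexHull ℝ ((fun (v : Fin n → ℤ) (j : Fin n) => (v j : ℝ)) '' S)) ?_
    ((convex_convexHull ℝ _).linear_preimage _)
  · exact h hz
  · rintro _ ⟨v, hv, rfl⟩
    exact subset_convexHull ℝ _ ⟨_, hS v hv, rfl⟩

namespace IsOrthogonal

theorem sub_mem_apartment {x y : Fin n → ℝ} (hx : x ∈ apartment n) (hy : y ∈ apartment n) :
    x - y ∈ apartment n := by
  obtain ⟨c, hc⟩ := hx
  obtain ⟨d, hd⟩ := hy
  refine ⟨c - d, fun j => ?_⟩
  rw [← hc j, ← hd j, Pi.sub_apply, Pi.sub_apply]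
  ring

/-- With y the mirror image of x, the linear reflection moves y - p along the coroot line, and x - p
lies between y - p and its image. The weights are proportional to the values of the affine root at p
and at x; they are nonnegative because p and x are on the same side. -/
theorem sub_mem_of_reflect {C : Set (Fin n → ℝ)} (hC : Convex ℝ C) {r : Fin n × Fin n × ℤ}
    (hr : IsAffRoot r) (hCr : ∀ z ∈ C, (fun j => z (reflPerm r.1 r.2.1 j)) ∈ C)
    {p x : Fin n → ℝ} (hp : p ∈ apartment n) (hx : x ∈ apartment n)
    (hpos : 0 < affVal r p * affVal r x) (h : affAct (rootRefl r) x - p ∈ C) : x - p ∈ C := by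
  set y := affAct (rootRefl r) x with hy
  have hya : y ∈ apartment n := affAct_mem_apartment (affRefl_mem_signedAffPerms hr _) hx
  have h1 := hCr _ h
  have h2 : affVal r y = -affVal r x := affVal_affAct_rootRefl_self hr hx
  have h3 : ∀ k, y k = x k - affVal r x * (corootVec r.1 r.2.1 k : ℝ) :=
    fun k => affAct_affRefl hr r.2.2 hx k
  have h4 := comp_reflPerm hr (sub_mem_apartment hya hp)
  set A := affVal r x with hA
  set B := affVal r p with hB
  have h5 : (y - p) r.1 - (y - p) r.2.1 = -(A + B) := by
    simp only [affVal] at h2 hB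
    simp only [Pi.sub_apply]
    linarith
  have hAB : A + B ≠ 0 := by
    intro h0
    have : A = -B := by linarith
    rw [this] at hpos
    nlinarith [mul_self_nonneg B]
  have hw : 0 ≤ B / (A + B) ∧ 0 ≤ A / (A + B) := by
    rcases pos_and_pos_or_neg_and_neg_of_mul_pos hpos with ⟨a, b⟩ | ⟨a, b⟩
    · constructor <;> positivity
    · exact ⟨div_nonneg_of_nonpos a.le (by linarith), div_nonneg_of_nonpos b.le (by linarith)⟩
  have h6 := hC h h1 hw.1 hw.2 (by field_simp; ring)
  convert h6 using 1
  funext k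
  simp only [Pi.add_apply, Pi.smul_apply, smul_eq_mul, h4, h5]
  simp only [Pi.sub_apply, h3]
  field_simp
  ring

/-- At the top, t_λ p - p = λ lies in the orbit; each step down the Bruhat order is handled by
`sub_mem_of_reflect`. The congruence modulo the affine Weyl group comes from λ - μ being in the
translation lattice. -/
theorem adm_subset_perm (hR : R.IsOrthogonal) {μ : Fin n → ℤ} {e : ℤ}
    (hμ : ∀ j, μ j + μ j.rev = 2 * e) : R.Adm μ ⊆ R.Perm μ := by
  rintro _ ⟨hw, _, ⟨σ, hσ, rfl⟩, x, hx, y, hy, τ, hτ, rfl, hyτ, hle⟩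
  refine ⟨hw, ?_, fun p hp => ?_⟩
  · have h1 := hR.comp_sub_mem_translLattice hμ (hR.weyl_le (inv_mem hσ))
    have h2 : transl _ ∈ R.affWeyl := h1
    rw [transl_sub, hyτ] at h2
    have : x * τ * (transl μ)⁻¹ = x * y⁻¹ * (y * τ * (transl μ)⁻¹) := by group
    rw [this]
    exact mul_mem (mul_mem hx (inv_mem hy)) h2
  · have hq : affAct τ p ∈ R.alcove := by
      rw [← hτ.2]
      exact ⟨p, hp, rfl⟩
    have hμR : ∀ v ∈ R.orbit μ, ∀ i j, IsRootIndex i j →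
        (fun k => v (reflPerm i j k)) ∈ R.orbit μ :=
      fun v hv i j h => comp_mem_orbit hv (hR.reflPerm_mem i j h)
    refine hR.bruhatLE_induction (P := fun z => affAct (z * τ) p - p ∈ convexHull ℝ
      ((fun (v : Fin n → ℤ) (j : Fin n) => (v j : ℝ)) '' R.orbit μ)) hx hle ?_ ?_
    · rw [← hyτ]
      refine subset_convexHull ℝ _ ⟨_, ⟨σ, hσ, rfl⟩, ?_⟩
      funext j
      simp [affAct]
    · intro z hz r hr hside h
      refine sub_mem_of_reflect (convex_convexHull ℝ _) hr (fun u hu =>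
        comp_mem_convexHull (fun v hv => hμR v hv _ _ hr) hu) hp.1 ?_ ?_ ?_
      · rw [affAct_mul]
        exact affAct_mem_apartment (hR.affWeyl_le hz) hq.1
      · rw [affAct_mul]
        have h1 := hside _ hq
        have h2 := hR.affVal_mul_pos hp hq hr
        rcases pos_and_pos_or_neg_and_neg_of_mul_pos h2 with ⟨a, b⟩ | ⟨a, b⟩
        · exact mul_pos a ((pos_iff_pos_of_mul_pos h1).1 b)
        · exact mul_pos_of_neg_of_neg a ((neg_iff_neg_of_mul_pos h1).1 b)
      · rwa [mul_assoc, affAct_mul] at h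

/-! ## Counting separating affine roots -/

/-- The affine roots that are positive on the base alcove and negative on its image. -/
def separating (g : AffPerm n) : Set (Fin n × Fin n × ℤ) :=
  {r | IsAffRoot r ∧ 0 < affVal r (basePoint n) ∧ affVal r (affAct g (basePoint n)) < 0}

/-- The indicator of `j < i`. -/
def ltInd (i j : Fin n) : ℤ := if j < i then 1 else 0

/-- The number of affine roots with gradient `α_{i,j}` that separate the base alcove from its
image under `g`. -/
def sepCount (g : AffPerm n) (i j : Fin n) : ℕ :=
  (ltInd i j - translPart g i + translPart g j - ltInd (g.right⁻¹ i) (g.right⁻¹ j)).toNat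

instance : DecidableRel (IsRootIndex (n := n)) := fun i j =>
  inferInstanceAs (Decidable (j ≠ i ∧ j ≠ i.rev))

theorem isPosRoot_iff (r : Fin n × Fin n × ℤ) : IsPosRoot r ↔ r.2.2 < ltInd r.1 r.2.1 := by
  unfold IsPosRoot ltInd
  split_ifs with h
  · simp only [h, and_true]
    omega
  · simp [h]

theorem affVal_affAct_neg_iff (hR : R.IsOrthogonal) {x : Fin n → ℝ} (hx : x ∈ R.alcove)
    {g : AffPerm n} (hg : g ∈ signedAffPerms n) {r : Fin n × Fin n × ℤ} (hr : IsAffRoot r) :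
    affVal r (affAct g x) < 0 ↔
      translPart g r.1 - translPart g r.2.1 + ltInd (g.right⁻¹ r.1) (g.right⁻¹ r.2.1) ≤ r.2.2 := by
  have h := affVal_rootAct g (rootAct g⁻¹ r) x
  rw [← rootAct_mul, mul_inv_cancel, rootAct_one] at h
  have key : ∀ k, translPart g⁻¹ (g.right⁻¹ k) = -translPart g k := by
    intro k
    have := translPart_mul g g⁻¹ k
    rw [mul_inv_cancel, translPart_one] at this
    linarith
  rw [h, (hR.affVal_pos_iff hx (hr.rootAct (inv_mem hg))).2, isPosRoot_iff, not_lt]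
  simp only [rootAct, SemidirectProduct.inv_right, key]
  constructor <;> intro h <;> linarith

/-- For a fixed gradient the separating levels `d` fill a half-open integer interval, whose size is
`sepCount`; `toNat` accounts for empty intervals. Each hyperplane is counted twice, once per index
pair of its root, which does not affect comparisons. -/
theorem separating_eq (hR : R.IsOrthogonal) {g : AffPerm n} (hg : g ∈ signedAffPerms n) :
    ∃ S : Finset (Fin n × Fin n × ℤ), separating g = S ∧
      S.card = ∑ i, ∑ j, if IsRootIndex i j then sepCount g i j else 0 := by
  let S := (Finset.univ.filter fun p : Fin n × Fin n => IsRootIndex p.1 p.2).sigma fun p =>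
    Finset.Ico (translPart g p.1 - translPart g p.2 + ltInd (g.right⁻¹ p.1) (g.right⁻¹ p.2))
      (ltInd p.1 p.2)
  have hinj : Function.Injective
      fun s : (_ : Fin n × Fin n) × ℤ => ((s.1.1, s.1.2, s.2) : Fin n × Fin n × ℤ) := by
    rintro ⟨⟨i, j⟩, d⟩ ⟨⟨i', j'⟩, d'⟩ h
    simp only [Prod.mk.injEq] at h
    obtain ⟨rfl, rfl, rfl⟩ := h
    rfl
  refine ⟨S.image fun s => (s.1.1, s.1.2, s.2), ?_, ?_⟩
  · ext ⟨i, j, d⟩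
    simp only [separating, Finset.coe_image, Set.mem_image, Finset.mem_coe, S, Finset.mem_sigma,
      Finset.mem_filter, Finset.mem_univ, true_and, Finset.mem_Ico, Sigma.exists, Prod.exists,
      Prod.mk.injEq, Set.mem_ofPred_eq]
    constructor
    · rintro ⟨h1, h2, h3⟩
      rw [(hR.affVal_pos_iff hR.basePoint_mem_alcove h1).1, isPosRoot_iff] at h2
      rw [hR.affVal_affAct_neg_iff hR.basePoint_mem_alcove hg h1] at h3
      exact ⟨i, j, d, ⟨h1, h3, h2⟩, rfl, rfl, rfl⟩
    · rintro ⟨i, j, d, ⟨h, h3, h2⟩, rfl, rfl, rfl⟩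
      have h1 : IsAffRoot (i, j, d) := h
      refine ⟨h1, ?_, ?_⟩
      · rwa [(hR.affVal_pos_iff hR.basePoint_mem_alcove h1).1, isPosRoot_iff]
      · rwa [hR.affVal_affAct_neg_iff hR.basePoint_mem_alcove hg h1]
  · rw [Finset.card_image_of_injective _ hinj, Finset.card_sigma, Finset.sum_filter,
      ← Finset.univ_product_univ, Finset.sum_product]
    refine Finset.sum_congr rfl fun i _ => Finset.sum_congr rfl fun j _ => ?_
    simp only [Int.card_Ico, sepCount]
    split_ifs
    · congr 1
      ring
    · rfl

theorem ncard_separating (hR : R.IsOrthogonal) {g : AffPerm n} (hg : g ∈ signedAffPerms n) :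
    (separating g).ncard = ∑ i, ∑ j, if IsRootIndex i j then sepCount g i j else 0 := by
  obtain ⟨S, h1, h2⟩ := hR.separating_eq hg
  rw [h1, Set.ncard_coe_finset, h2]

theorem finite_separating (hR : R.IsOrthogonal) {g : AffPerm n} (hg : g ∈ signedAffPerms n) :
    (separating g).Finite := by
  obtain ⟨S, h1, -⟩ := hR.separating_eq hg
  rw [h1]
  exact S.finite_toSet

theorem affVal_rootRefl_rootAct {r r' : Fin n × Fin n × ℤ} (hr : IsAffRoot r) (x : Fin n → ℝ) :
    affVal (rootAct (rootRefl r) r') x = affVal r' (affAct (rootRefl r) x) := by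
  have h := affVal_rootAct (rootRefl r) (rootAct (rootRefl r) r') x
  rwa [← rootAct_mul, rootRefl_mul_self hr, rootAct_one, eq_comm] at h

/-- Reflecting away from the base alcove increases the number of separating affine roots. -/
theorem ncard_separating_lt_of_pos (hR : R.IsOrthogonal) {g : AffPerm n}
    (hg : g ∈ signedAffPerms n) {r : Fin n × Fin n × ℤ} (hr : IsAffRoot r)
    (h1 : 0 < affVal r (basePoint n)) (h2 : 0 < affVal r (affAct g (basePoint n))) :
    (separating g).ncard < (separating (rootRefl r * g)).ncard := by
  classical
  have hb : basePoint n ∈ apartment n := basePoint_mem_apartment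
  have hgb := affAct_mem_apartment hg hb
  have hrg : rootRefl r ∈ signedAffPerms n := affRefl_mem_signedAffPerms hr _
  set t := rootRefl r with ht
  -- An injection between the two sets of separating roots: a root that still separates is kept, any
  -- other is reflected. Its image misses `r`, so the count grows strictly.
  let φ : Fin n × Fin n × ℤ → Fin n × Fin n × ℤ :=
    fun r' => if r' ∈ separating (t * g) then r' else rootAct t r'
  have hinvol : ∀ r', rootAct t (rootAct t r') = r' := fun r' => by
    rw [← rootAct_mul, ht, rootRefl_mul_self hr, rootAct_one]
  have hval : ∀ r' x, affVal (rootAct t r') x = affVal r' (affAct t x) :=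
    fun r' x => affVal_rootRefl_rootAct hr x
  have htt : ∀ x, affAct t (affAct t x) = x := fun x => by
    rw [← affAct_mul, ht, rootRefl_mul_self hr, affAct_one]
  have hmove : ∀ r' ∈ separating g, r' ∉ separating (t * g) →
      rootAct t r' ∈ separating (t * g) ∧ rootAct t r' ∉ separating g := by
    rintro r' ⟨a1, a2, a3⟩ hnot
    have a4 : 0 ≤ affVal r' (affAct t (affAct g (basePoint n))) := by
      by_contra hc
      exact hnot ⟨a1, a2, by rw [affAct_mul]; exact not_le.1 hc⟩
    refine ⟨⟨a1.rootAct hrg, ?_, ?_⟩, ?_⟩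
    · rw [hval, ht, affVal_affAct_rootRefl hr hb]
      rw [ht, affVal_affAct_rootRefl hr hgb] at a4
      -- The reflection raises `r'` from negative to nonnegative at the image of the base point,
      -- which forces a negative pairing with the coroot; hence it raises `r'` at the base point
      -- too.
      have hc : ((corootVec r.1 r.2.1 r'.1 : ℝ) - corootVec r.1 r.2.1 r'.2.1) < 0 := by
        by_contra hc
        have := mul_nonneg h2.le (not_lt.1 hc)
        linarith
      have := mul_neg_of_pos_of_neg h1 hc
      linarith
    · rw [hval, affAct_mul, htt]
      exact a3
    · rintro ⟨-, -, b⟩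
      rw [hval] at b
      linarith
  have hmaps : ∀ r' ∈ separating g, φ r' ∈ separating (t * g) := by
    intro r' h
    by_cases hm : r' ∈ separating (t * g)
    · simp only [φ, hm, if_true]
    · simpa only [φ, hm, if_false] using (hmove r' h hm).1
  have hinj : Set.InjOn φ (separating g) := by
    intro a ha b hb hab
    by_cases hma : a ∈ separating (t * g) <;> by_cases hmb : b ∈ separating (t * g) <;>
      simp only [φ, hma, hmb, if_true, if_false] at hab
    · exact hab
    · exact absurd (hab ▸ ha) (hmove b hb hmb).2
    · exact absurd (hab.symm ▸ hb) (hmove a ha hma).2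
    · rw [← hinvol a, hab, hinvol]
  have hr_mem : r ∈ separating (t * g) := by
    refine ⟨hr, h1, ?_⟩
    rw [affAct_mul, ht, affVal_affAct_rootRefl_self hr hgb]
    linarith
  have hr_not : r ∉ φ '' separating g := by
    rintro ⟨r', ha, hab⟩
    by_cases hm : r' ∈ separating (t * g)
    · simp only [φ, hm, if_true] at hab
      have := ha.2.2
      rw [hab] at this
      linarith
    · simp only [φ, hm, if_false] at hab
      have h3 := ha.2.1
      rw [← hinvol r', hab, hval, ht, affVal_affAct_rootRefl_self hr hb] at h3
      linarith
  rw [← hinj.ncard_image]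
  refine Set.ncard_lt_ncard ⟨?_, fun h => hr_not (h hr_mem)⟩
    (hR.finite_separating (mul_mem hrg hg))
  rintro _ ⟨a, ha, rfl⟩
  exact hmaps a ha

theorem ncard_separating_lt (hR : R.IsOrthogonal) {g : AffPerm n}
    (hg : g ∈ signedAffPerms n) {r : Fin n × Fin n × ℤ} (hr : IsAffRoot r)
    (h : 0 < affVal r (basePoint n) * affVal r (affAct g (basePoint n))) :
    (separating g).ncard < (separating (rootRefl r * g)).ncard := by
  rcases pos_and_pos_or_neg_and_neg_of_mul_pos h with ⟨a, b⟩ | ⟨a, b⟩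
  · exact hR.ncard_separating_lt_of_pos hg hr a b
  · obtain ⟨i, j, d⟩ := r
    have e : rootRefl (i, j, d) = rootRefl (j, i, -d) := (affRefl_swap hr d).symm
    have hv : ∀ x : Fin n → ℝ, affVal (j, i, -d) x = -affVal (i, j, d) x := fun x => by
      simp only [affVal]
      push_cast
      ring
    rw [e]
    refine hR.ncard_separating_lt_of_pos hg (IsRootIndex.symm hr) ?_ ?_ <;> rw [hv] <;> linarith

/-- The factor τ preserves the alcove, so the side conditions supplied by the Bruhat induction hold
for zτ as well, and every upward step increases the count. -/
theorem eq_or_ncard_separating_lt (hR : R.IsOrthogonal) {x y τ : AffPerm n} (hx : x ∈ R.affWeyl)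
    (hτ : τ ∈ R.alcoveStab) (hxy : BruhatLE R.simpleRefls x y) :
    x = y ∨ (separating (x * τ)).ncard < (separating (y * τ)).ncard := by
  have hτ' : τ ∈ signedAffPerms n := ⟨hτ.1.1, hR.weyl_le hτ.1.2⟩
  have hb := hR.basePoint_mem_alcove
  have hq : affAct τ (basePoint n) ∈ R.alcove := by
    rw [← hτ.2]
    exact ⟨_, hb, rfl⟩
  refine hR.bruhatLE_induction
    (P := fun z => z = y ∨ (separating (z * τ)).ncard < (separating (y * τ)).ncard)
    hx hxy (Or.inl rfl) ?_
  intro z hz r hr hside h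
  right
  have hlt : (separating (z * τ)).ncard < (separating (rootRefl r * z * τ)).ncard := by
    rw [mul_assoc]
    refine hR.ncard_separating_lt (mul_mem (hR.affWeyl_le hz) hτ') hr ?_
    rw [affAct_mul]
    have h1 := hside _ hq
    have h2 := hR.affVal_mul_pos hb hq hr
    rcases pos_and_pos_or_neg_and_neg_of_mul_pos h2 with ⟨a, b⟩ | ⟨a, b⟩
    · exact mul_pos a ((pos_iff_pos_of_mul_pos h1).1 b)
    · exact mul_pos_of_neg_of_neg a ((neg_iff_neg_of_mul_pos h1).1 b)
  rcases h with h | h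
  · rwa [h] at hlt
  · exact hlt.trans h

end IsOrthogonal

end WeylData

/-! ## A permissible element that is not admissible -/

/-- `t_ν (q-1, (q-1)*) (q, q*)` with `ν = (2^{(q-2)}, 1, …, 1, 0^{(q-2)})`. -/
def flipElt (n q : ℕ) (a b : Fin n) : AffPerm n :=
  transl (muVec n (q - 2)) * permElt (Equiv.swap a a.rev * Equiv.swap b b.rev)

namespace WeylData.IsOrthogonal

variable {n : ℕ} {R : WeylData n}

theorem muVec_add_rev {q : ℕ} (hq : 2 * q < n) (j : Fin n) :
    muVec n q j + muVec n q j.rev = 2 * 1 := by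
  have := j.isLt
  simp only [muVec, Fin.val_rev]
  split_ifs <;> omega

theorem isRootIndex_iff_perm {σ : Equiv.Perm (Fin n)} (hσ : σ ∈ signedPerms n) (i j : Fin n) :
    IsRootIndex (σ i) (σ j) ↔ IsRootIndex i j := by
  unfold IsRootIndex
  rw [← hσ i, σ.injective.ne_iff, σ.injective.ne_iff]

/-- For a translation the order indicators cancel and a summand depends only on v_j - v_i, so
permuting the entries merely reindexes the sum. -/
theorem sum_sepCount_transl (hR : R.IsOrthogonal) (μ : Fin n → ℤ) {v : Fin n → ℤ}
    (hv : v ∈ R.orbit μ) :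
    ∑ i, ∑ j, (if IsRootIndex i j then sepCount (transl v) i j else 0) =
      ∑ i, ∑ j, if IsRootIndex i j then sepCount (transl μ) i j else 0 := by
  obtain ⟨σ, hσ, rfl⟩ := hv
  have hs := hR.weyl_le hσ
  rw [← Equiv.sum_comp σ]
  refine Finset.sum_congr rfl fun i _ => ?_
  rw [← Equiv.sum_comp σ]
  refine Finset.sum_congr rfl fun j _ => ?_
  simp only [isRootIndex_iff_perm hs]
  split_ifs
  · simp only [sepCount, translPart_transl, transl_right, inv_one, Equiv.Perm.one_apply,
      show ∀ k, σ⁻¹ (σ k) = k from σ.symm_apply_apply]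
    congr 1
    ring
  · rfl

/-- The counts of w and t_μ differ root by root and agree only on blocks ±α_{i,j}, ±α_{i,j*}; this
rewrites the total in terms of such blocks. -/
theorem four_mul_sum (F : Fin n → Fin n → ℕ) :
    4 * ∑ i, ∑ j, F i j = ∑ i, ∑ j, (F i j + F j i + F i (Fin.rev j) + F (Fin.rev j) i) := by
  have h1 : ∑ i, ∑ j, F j i = ∑ i, ∑ j, F i j := Finset.sum_comm
  have h2 : ∀ G : Fin n → Fin n → ℕ, ∑ i, ∑ j, G i (Fin.rev j) = ∑ i, ∑ j, G i j := fun G =>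
    Finset.sum_congr rfl fun i _ => Equiv.sum_comp Fin.revPerm (G i)
  have h3 := h2 fun i j => F j i
  have h4 := h2 F
  simp only [Finset.sum_add_distrib]
  omega

theorem flipPerm_apply {a b : Fin n} (hab : IsRootIndex a b) (i : Fin n) :
    (Equiv.swap a a.rev * Equiv.swap b b.rev) i =
      if i = a ∨ i = a.rev ∨ i = b ∨ i = b.rev then i.rev else i := by
  obtain ⟨h1, h2⟩ := hab
  have h3 : a ≠ b.rev := fun e => h2 (by rw [e, Fin.rev_rev])
  have h4 : a.rev ≠ b.rev := fun e => h1 (Fin.rev_injective e).symm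
  rw [Equiv.Perm.mul_apply]
  by_cases e1 : i = a
  · subst e1
    rw [Equiv.swap_apply_of_ne_of_ne h1.symm h3]
    simp
  by_cases e2 : i = a.rev
  · subst e2
    rw [Equiv.swap_apply_of_ne_of_ne h2.symm h4]
    simp
  by_cases e3 : i = b
  · subst e3
    rw [Equiv.swap_apply_left, Equiv.swap_apply_of_ne_of_ne h3.symm h4.symm]
    simp
  by_cases e4 : i = b.rev
  · subst e4
    rw [Equiv.swap_apply_right, Equiv.swap_apply_of_ne_of_ne h1 h2]
    simp
  · rw [Equiv.swap_apply_of_ne_of_ne e3 e4, Equiv.swap_apply_of_ne_of_ne e1 e2]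
    simp [e1, e2, e3, e4]

/-- The positions of an index relative to `q`. -/
theorem flip_cases {q : ℕ} (h3 : 3 ≤ q) (hq : 2 * q < n) {a b : Fin n} (ha : a.val = q - 2)
    (hb : b.val = q - 1) (i : Fin n) :
    ((Equiv.swap a a.rev * Equiv.swap b b.rev) i = i ∧
      ((i.val < q - 2 ∧ muVec n (q - 2) i = 2 ∧ muVec n q i = 2) ∨
      (q ≤ i.val ∧ i.val < n - q ∧ muVec n (q - 2) i = 1 ∧ muVec n q i = 1) ∨
      (n - q + 2 ≤ i.val ∧ muVec n (q - 2) i = 0 ∧ muVec n q i = 0))) ∨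
    ((Equiv.swap a a.rev * Equiv.swap b b.rev) i = i.rev ∧
      ((q - 2 ≤ i.val ∧ i.val < q ∧ muVec n (q - 2) i = 1 ∧ muVec n q i = 2) ∨
      (n - q ≤ i.val ∧ i.val < n - q + 2 ∧ muVec n (q - 2) i = 1 ∧ muVec n q i = 0))) := by
  have hi := i.isLt
  have hab : IsRootIndex a b := by
    constructor <;> simp only [ne_eq, Fin.ext_iff, Fin.val_rev] <;> omega
  have h : (i = a ∨ i = a.rev ∨ i = b ∨ i = b.rev) ↔
      ((q - 2 ≤ i.val ∧ i.val < q) ∨ (n - q ≤ i.val ∧ i.val < n - q + 2)) := by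
    simp only [Fin.ext_iff, Fin.val_rev]
    omega
  rw [flipPerm_apply hab]
  simp only [h, muVec]
  split_ifs with h1 h2 h3 h4 h5 h6 <;> simp <;> omega

theorem flipPerm_mem {a b : Fin n} :
    Equiv.swap a a.rev * Equiv.swap b b.rev ∈ signedPerms n :=
  mul_mem (swap_rev_mem_signedPerms a) (swap_rev_mem_signedPerms b)

theorem flipPerm_inv {a b : Fin n} (h : IsRootIndex a b) :
    (Equiv.swap a a.rev * Equiv.swap b b.rev)⁻¹ = Equiv.swap a a.rev * Equiv.swap b b.rev := by
  rw [mul_inv_rev, Equiv.swap_inv, Equiv.swap_inv, swap_mul_swap_comm]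
  · exact h.1
  · exact h.2
  · exact fun e => h.2 (by rw [← e, Fin.rev_rev])
  · exact fun e => h.1 (Fin.rev_injective e)

theorem ltInd_cases (i j : Fin n) :
    (j.val < i.val ∧ ltInd i j = 1) ∨ (i.val ≤ j.val ∧ ltInd i j = 0) := by
  unfold ltInd
  split_ifs with h
  · exact Or.inl ⟨h, rfl⟩
  · exact Or.inr ⟨not_lt.1 h, rfl⟩

-- For the block of the two flipped indices both sides are 2: w gets 1 from (b, a) and 1 from (b*,
-- a), while t_μ gets 2 from (b*, a) alone. The other blocks are settled by the positions of i and j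
-- relative to q, each being a statement of linear arithmetic.
set_option maxHeartbeats 4000000 in
theorem sepCount_flipElt {q : ℕ} (h3 : 3 ≤ q) (hq : 2 * q < n) {a b : Fin n} (ha : a.val = q - 2)
    (hb : b.val = q - 1) (hab : IsRootIndex a b) {i j : Fin n} (hij : IsRootIndex i j) :
    sepCount (flipElt n q a b) i j + sepCount (flipElt n q a b) j i +
        sepCount (flipElt n q a b) i j.rev + sepCount (flipElt n q a b) j.rev i =
      sepCount (transl (muVec n q)) i j + sepCount (transl (muVec n q)) j i +
        sepCount (transl (muVec n q)) i j.rev + sepCount (transl (muVec n q)) j.rev i := by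
  have hn1 := hij.1
  have hn2 := hij.2
  have hi := i.isLt
  have hj := j.isLt
  have e1 := muVec_add_rev (q := q) hq j
  have e2 := muVec_add_rev (n := n) (q := q - 2) (by omega) j
  have e3 : j.rev.val = n - (j.val + 1) := Fin.val_rev j
  have e4 : i.rev.val = n - (i.val + 1) := Fin.val_rev i
  rw [ne_eq, Fin.ext_iff] at hn1 hn2
  rw [e4] at hn2
  have hσ := flipPerm_mem (a := a) (b := b) j
  have c1 := ltInd_cases i j
  have c2 := ltInd_cases j i
  have c3 := ltInd_cases i j.rev
  have c4 := ltInd_cases j.rev i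
  have c5 := ltInd_cases i.rev j
  have c6 := ltInd_cases j i.rev
  have c7 := ltInd_cases i.rev j.rev
  have c8 := ltInd_cases j.rev i.rev
  have pi := flip_cases h3 hq ha hb i
  have pj := flip_cases h3 hq ha hb j
  simp only [sepCount, flipElt, translPart_mul, translPart_transl, translPart_permElt,
    SemidirectProduct.mul_right, transl_right, permElt_right, one_mul, flipPerm_inv hab,
    inv_one, Equiv.Perm.one_apply, Pi.zero_apply, add_zero]
  generalize (Equiv.swap a a.rev * Equiv.swap b b.rev) = σ at *
  rcases pi with ⟨s1, pi⟩ | ⟨s1, pi⟩ <;> rcases pj with ⟨s2, pj⟩ | ⟨s2, pj⟩ <;>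
    rw [s2] at hσ <;> rw [s1, hσ, s2] <;> try rw [Fin.rev_rev]
  all_goals
    generalize ltInd i j = x1 at *
    generalize ltInd j i = x2 at *
    generalize ltInd i j.rev = x3 at *
    generalize ltInd j.rev i = x4 at *
    generalize ltInd i.rev j = x5 at *
    generalize ltInd j i.rev = x6 at *
    generalize ltInd i.rev j.rev = x7 at *
    generalize ltInd j.rev i.rev = x8 at *
    generalize muVec n q i = y1 at *
    generalize muVec n q j = y2 at *
    generalize muVec n q j.rev = y3 at *
    generalize muVec n (q - 2) i = y4 at *
    generalize muVec n (q - 2) j = y5 at *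
    generalize muVec n (q - 2) j.rev = y6 at *
    rw [e3] at c3 c4 c7 c8
    rw [e4] at c5 c6 c7 c8
    clear s1 s2 hσ e3 e4
    generalize i.val = u at *
    generalize j.val = v at *
  · rcases pi with pi | pi | pi <;> rcases pj with pj | pj | pj <;> omega
  · rcases pi with pi | pi | pi <;> rcases pj with pj | pj <;> omega
  · rcases pi with pi | pi <;> rcases pj with pj | pj | pj <;> omega
  · rcases pi with pi | pi <;> rcases pj with pj | pj <;> omega

end WeylData.IsOrthogonal

/-! ### The flipped element: not admissible, yet permissible -/

namespace WeylData.IsOrthogonal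

variable {n : ℕ} {R : WeylData n}

theorem isRootIndex_flip {q : ℕ} (h3 : 3 ≤ q) (hq : 2 * q < n) {a b : Fin n}
    (ha : a.val = q - 2) (hb : b.val = q - 1) : IsRootIndex a b := by
  constructor <;> simp only [ne_eq, Fin.ext_iff, Fin.val_rev] <;> omega

theorem muVec_mem_cocharGroup {q : ℕ} (hq : 2 * q < n) : muVec n q ∈ cocharGroup n :=
  ⟨2 * 1, muVec_add_rev hq⟩

theorem flipElt_mem {q : ℕ} (hq : 2 * q < n) (a b : Fin n) :
    flipElt n q a b ∈ signedAffPerms n := by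
  refine mul_mem (s := signedAffPerms n) ⟨?_, one_mem _⟩ ⟨zero_mem _, flipPerm_mem⟩
  exact muVec_mem_cocharGroup (by omega)

theorem flipElt_right (q : ℕ) (a b : Fin n) :
    (flipElt n q a b).right = Equiv.swap a a.rev * Equiv.swap b b.rev := by
  simp [flipElt]

theorem flipElt_notMem_adm (hR : R.IsOrthogonal) {q : ℕ} (h3 : 3 ≤ q) (hq : 2 * q < n)
    {a b : Fin n} (ha : a.val = q - 2) (hb : b.val = q - 1) :
    flipElt n q a b ∉ R.Adm (muVec n q) := by
  rintro ⟨-, v, hv, x, hx, y, hy, τ, hτ, hxτ, hyτ, hle⟩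
  have hab := isRootIndex_flip h3 hq ha hb
  have hw := flipElt_mem hq a b
  have hτ' : τ ∈ signedAffPerms n := ⟨hτ.1.1, hR.weyl_le hτ.1.2⟩
  -- Equality would make the element a translation, but its linear part moves `a`; a strict
  -- inequality contradicts the equal counts.
  rcases hR.eq_or_ncard_separating_lt hx hτ hle with h | h
  · have h1 : flipElt n q a b = transl v := by rw [hxτ, hyτ, h]
    have h2 : (Equiv.swap a a.rev * Equiv.swap b b.rev) a = a := by
      rw [← flipElt_right q, h1, transl_right, Equiv.Perm.one_apply]
    rw [flipPerm_apply hab, if_pos (Or.inl rfl), Fin.ext_iff, Fin.val_rev] at h2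
    omega
  · have ht : transl v ∈ signedAffPerms n := by
      rw [hyτ]
      exact mul_mem (hR.affWeyl_le hy) hτ'
    rw [← hxτ, ← hyτ, hR.ncard_separating hw, hR.ncard_separating ht,
      hR.sum_sepCount_transl _ hv] at h
    have h1 := four_mul_sum fun i j : Fin n =>
      if IsRootIndex i j then sepCount (flipElt n q a b) i j else 0
    have h2 := four_mul_sum fun i j : Fin n =>
      if IsRootIndex i j then sepCount (transl (muVec n q)) i j else 0
    have h4 : ∀ i j : Fin n, IsRootIndex i j → IsRootIndex j i ∧ IsRootIndex i j.rev ∧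
        IsRootIndex j.rev i := fun i j h => ⟨h.symm, h.rev_right, h.rev_right.symm⟩
    have h5 : ∀ i j : Fin n, ¬ IsRootIndex i j → ¬ IsRootIndex j i ∧ ¬ IsRootIndex i j.rev ∧
        ¬ IsRootIndex j.rev i := fun i j h => ⟨fun e => h e.symm,
          fun e => h (by simpa using e.rev_right), fun e => h (by simpa using e.symm.rev_right)⟩
    have h6 : ∑ i : Fin n, ∑ j : Fin n,
        ((if IsRootIndex i j then sepCount (flipElt n q a b) i j else 0) +
          (if IsRootIndex j i then sepCount (flipElt n q a b) j i else 0) +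
          (if IsRootIndex i j.rev then sepCount (flipElt n q a b) i j.rev else 0) +
          (if IsRootIndex j.rev i then sepCount (flipElt n q a b) j.rev i else 0)) =
        ∑ i : Fin n, ∑ j : Fin n,
        ((if IsRootIndex i j then sepCount (transl (muVec n q)) i j else 0) +
          (if IsRootIndex j i then sepCount (transl (muVec n q)) j i else 0) +
          (if IsRootIndex i j.rev then sepCount (transl (muVec n q)) i j.rev else 0) +
          (if IsRootIndex j.rev i then sepCount (transl (muVec n q)) j.rev i else 0)) := by
      refine Finset.sum_congr rfl fun i _ => Finset.sum_congr rfl fun j _ => ?_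
      by_cases hij : IsRootIndex i j
      · obtain ⟨k1, k2, k3⟩ := h4 i j hij
        simp only [hij, k1, k2, k3, if_true]
        exact sepCount_flipElt h3 hq ha hb hab hij
      · obtain ⟨k1, k2, k3⟩ := h5 i j hij
        simp only [hij, k1, k2, k3, if_false]
    rw [h6, ← h2] at h1
    omega

/-- A double sign change is the product of the reflections in the orthogonal roots α_{a,b} and
α_{a,b*}, so it lies in the Weyl group in both types. -/
theorem flipPerm_eq {a b : Fin n} (hab : IsRootIndex a b) (ha : a.rev ≠ a) (hb : b.rev ≠ b) :
    Equiv.swap a a.rev * Equiv.swap b b.rev = reflPerm a b * reflPerm a b.rev := by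
  have hb' : b ≠ b.rev := hb.symm
  obtain ⟨h1, h2⟩ := id hab
  have h3 : a ≠ b.rev := fun e => h2 (by rw [e, Fin.rev_rev])
  have h4 : a.rev ≠ b.rev := fun e => h1 (Fin.rev_injective e).symm
  ext1 k
  rw [flipPerm_apply hab]
  simp only [reflPerm, ha, hb, Fin.rev_rev, if_false, if_neg hb', Equiv.Perm.mul_apply]
  by_cases e1 : k = a
  · subst e1
    simp [Equiv.swap_apply_of_ne_of_ne, *, h1.symm, h2.symm, ha.symm]
  by_cases e2 : k = a.rev
  · subst e2
    simp [Equiv.swap_apply_of_ne_of_ne, *, h2.symm]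
  by_cases e3 : k = b
  · subst e3
    simp [Equiv.swap_apply_of_ne_of_ne, *, h3.symm]
  by_cases e4 : k = b.rev
  · subst e4
    simp [Equiv.swap_apply_of_ne_of_ne, *, h3.symm, h4.symm, ha.symm]
  · simp [Equiv.swap_apply_of_ne_of_ne, *]

/-- The flips turn the 2s of μ at a, b into 0s; adding e_a + e_b - e_{a*} - e_{b*}, the coroot of
α_{a,b*}, brings all four entries to 1. Hence w t_μ⁻¹ is a coroot translation times the flip. -/
theorem muVec_sub_two {q : ℕ} (h3 : 3 ≤ q) (hq : 2 * q < n) {a b : Fin n} (ha : a.val = q - 2)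
    (hb : b.val = q - 1) (k : Fin n) : muVec n (q - 2) k = corootVec a b.rev k +
      muVec n q ((Equiv.swap a a.rev * Equiv.swap b b.rev) k) := by
  have hab := isRootIndex_flip h3 hq ha hb
  have ha' : a.rev ≠ a := by
    simp only [ne_eq, Fin.ext_iff, Fin.val_rev]
    omega
  have hb' : b.rev.rev ≠ b.rev := by
    simp only [ne_eq, Fin.ext_iff, Fin.val_rev]
    omega
  rw [corootVec_apply ha' hb', flipPerm_apply hab, Fin.rev_rev]
  have hk := k.isLt
  simp only [Fin.ext_iff, Fin.val_rev, ha, hb]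
  by_cases e1 : k.val = q - 2
  · simp only [e1, muVec, true_or, if_true, Fin.val_rev]
    split_ifs <;> omega
  by_cases e2 : k.val = q - 1
  · simp only [e2, muVec, true_or, or_true, if_true, Fin.val_rev]
    split_ifs <;> omega
  by_cases e3 : k.val = n - (q - 2 + 1)
  · simp only [e3, muVec, true_or, or_true, if_true, Fin.val_rev]
    split_ifs <;> omega
  by_cases e4 : k.val = n - (q - 1 + 1)
  · simp only [e4, muVec, or_true, if_true, Fin.val_rev]
    split_ifs <;> omega
  simp only [e1, e2, e3, e4, or_self, if_false, muVec]
  split_ifs <;> omega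

/-- Here (i, i*) is not a root index, so the bounds are indirect: x_i and x_{i*} both lie in (x_1,
x_1 + 1), and an index strictly between i and i* puts them in order. The first index itself is
excluded. -/
theorem rev_sub_mem_Ioo (hR : R.IsOrthogonal) {x : Fin n → ℝ} (hx : x ∈ R.alcove) {i : Fin n}
    (h1 : 1 ≤ i.val) (h2 : 2 * i.val + 2 < n) : x i.rev - x i ∈ Set.Ioo (0 : ℝ) 1 := by
  let o : Fin n := ⟨0, by omega⟩
  let k : Fin n := ⟨i.val + 1, by omega⟩
  have b1 := hR.sub_mem_Ioo x hx o i (by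
    constructor <;> simp only [ne_eq, Fin.ext_iff, Fin.val_rev, o] <;> omega)
    (by simp only [Fin.lt_def, o]; omega)
  have b2 := hR.sub_mem_Ioo x hx o i.rev (by
    constructor <;> simp only [ne_eq, Fin.ext_iff, Fin.val_rev, o] <;> omega)
    (by simp only [Fin.lt_def, Fin.val_rev, o]; omega)
  have b3 := hR.sub_mem_Ioo x hx i k (by
    constructor <;> simp only [ne_eq, Fin.ext_iff, Fin.val_rev, k] <;> omega)
    (by simp only [Fin.lt_def, k]; omega)
  have b4 := hR.sub_mem_Ioo x hx k i.rev (by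
    constructor <;> simp only [ne_eq, Fin.ext_iff, Fin.val_rev, k] <;> omega)
    (by simp only [Fin.lt_def, Fin.val_rev, k]; omega)
  have b5 := b1.2
  have b6 := b2.1
  have b7 := b3.2
  have b8 := b4.2
  constructor <;> linarith

theorem flipElt_mem_perm (hR : R.IsOrthogonal) {q : ℕ} (h3 : 3 ≤ q) (hq : 2 * q < n)
    {a b : Fin n} (ha : a.val = q - 2) (hb : b.val = q - 1)
    (hflip : ∀ v ∈ R.orbit (muVec n q), ∀ i, (fun j => v (Equiv.swap i i.rev j)) ∈
      R.orbit (muVec n q)) :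
    flipElt n q a b ∈ R.Perm (muVec n q) := by
  have hab := isRootIndex_flip h3 hq ha hb
  have ha' : a.rev ≠ a := by
    simp only [ne_eq, Fin.ext_iff, Fin.val_rev]
    omega
  have hb' : b.rev ≠ b := by
    simp only [ne_eq, Fin.ext_iff, Fin.val_rev]
    omega
  refine ⟨⟨(flipElt_mem hq a b).1, ?_⟩, ?_, fun x hx => ?_⟩
  · rw [flipElt_right, flipPerm_eq hab ha' hb']
    exact mul_mem (hR.reflPerm_mem _ _ hab) (hR.reflPerm_mem _ _ hab.rev_right)
  · have h1 : flipElt n q a b * (transl (muVec n q))⁻¹ =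
        transl (corootVec a b.rev) * permElt (Equiv.swap a a.rev * Equiv.swap b b.rev) := by
      rw [mul_inv_eq_iff_eq_mul]
      apply AffPerm.ext'
      · intro k
        simp only [flipElt, translPart_mul, translPart_transl, translPart_permElt,
          SemidirectProduct.mul_right, transl_right, permElt_right, one_mul, flipPerm_inv hab,
          inv_one, Equiv.Perm.one_apply, Pi.zero_apply, add_zero]
        exact muVec_sub_two h3 hq ha hb k
      · simp [flipElt]
    rw [h1]
    refine mul_mem (hR.corootVec_mem hab.rev_right) ?_
    rw [flipPerm_eq hab ha' hb', permElt_mul]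
    exact mul_mem (hR.permElt_mem _ _ hab) (hR.permElt_mem _ _ hab.rev_right)
  · set C := convexHull ℝ
      ((fun (v : Fin n → ℤ) (j : Fin n) => (v j : ℝ)) '' R.orbit (muVec n q)) with hC
    have hconv : Convex ℝ C := convex_convexHull ℝ _
    have hCflip : ∀ z ∈ C, ∀ i, (fun j => z (Equiv.swap i i.rev j)) ∈ C := fun z hz i =>
      comp_mem_convexHull (fun v hv => hflip v hv i) hz
    obtain ⟨a1, a2⟩ := hR.rev_sub_mem_Ioo hx (i := a) (by omega) (by omega)
    obtain ⟨b1, b2⟩ := hR.rev_sub_mem_Ioo hx (i := b) (by omega) (by omega)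
    have hμ : (fun j => (muVec n q j : ℝ)) ∈ C :=
      subset_convexHull ℝ _ ⟨_, self_mem_orbit _, rfl⟩
    -- With δ = x_{a*} - x_a, the weights (1 ± δ)/2 on the entries 2 and 0 give 1 + δ, the
    -- displacement at `a`. The same mixture is then made at `b`.
    have m1 := hconv hμ (hCflip _ hμ a)
      (a := (1 + (x a.rev - x a)) / 2) (b := (1 - (x a.rev - x a)) / 2)
      (by linarith) (by linarith) (by ring)
    have m2 := hconv m1 (hCflip _ m1 b)
      (a := (1 + (x b.rev - x b)) / 2) (b := (1 - (x b.rev - x b)) / 2)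
      (by linarith) (by linarith) (by ring)
    convert m2 using 1
    obtain ⟨h1, h2⟩ := id hab
    have g1 : a ≠ b.rev := fun e => h2 (by rw [e, Fin.rev_rev])
    have g2 : a.rev ≠ b.rev := fun e => h1 (Fin.rev_injective e).symm
    have va : muVec n q a = 2 ∧ muVec n (q - 2) a = 1 := by
      simp only [muVec]
      constructor <;> split_ifs <;> omega
    have vb : muVec n q b = 2 ∧ muVec n (q - 2) b = 1 := by
      simp only [muVec]
      constructor <;> split_ifs <;> omega
    have va' : muVec n q a.rev = 0 ∧ muVec n (q - 2) a.rev = 1 := by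
      simp only [muVec, Fin.val_rev]
      constructor <;> split_ifs <;> omega
    have vb' : muVec n q b.rev = 0 ∧ muVec n (q - 2) b.rev = 1 := by
      simp only [muVec, Fin.val_rev]
      constructor <;> split_ifs <;> omega
    funext k
    simp only [flipElt, affAct, translPart_mul, translPart_transl, translPart_permElt,
      SemidirectProduct.mul_right, transl_right, permElt_right, one_mul, flipPerm_inv hab,
      flipPerm_apply hab, inv_one, Pi.zero_apply, add_zero, Pi.add_apply, Pi.sub_apply,
      Pi.smul_apply, smul_eq_mul]
    by_cases e1 : k = a
    · subst e1
      simp [Equiv.swap_apply_of_ne_of_ne h1.symm g1, va, va']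
      ring
    by_cases e2 : k = a.rev
    · subst e2
      simp [Equiv.swap_apply_of_ne_of_ne h2.symm g2, va, va']
      ring
    by_cases e3 : k = b
    · subst e3
      simp [Equiv.swap_apply_of_ne_of_ne h1 h2, Equiv.swap_apply_of_ne_of_ne g1.symm g2.symm,
        vb, vb']
      ring
    by_cases e4 : k = b.rev
    · subst e4
      simp [Equiv.swap_apply_of_ne_of_ne h1 h2, Equiv.swap_apply_of_ne_of_ne g1.symm g2.symm,
        vb, vb']
      ring
    · have : muVec n (q - 2) k = muVec n q k := by
        simp only [Fin.ext_iff, Fin.val_rev] at e1 e2 e3 e4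
        simp only [muVec]
        split_ifs <;> omega
      simp only [Equiv.swap_apply_of_ne_of_ne e1 e2, Equiv.swap_apply_of_ne_of_ne e3 e4, e1, e2,
        e3, e4, or_self, if_false, this]
      ring

end WeylData.IsOrthogonal

/-! ## Types `D` and `B` -/

namespace WeylData

variable {n : ℕ} {R : WeylData n}

theorem reflPerm_cases {a b : Fin n} (h : IsRootIndex a b) (ha : a.rev ≠ a) (hb : b.rev ≠ b)
    (i : Fin n) : (i = a ∧ reflPerm a b i = b) ∨ (i = b ∧ reflPerm a b i = a) ∨
      (i = a.rev ∧ reflPerm a b i = b.rev) ∨ (i = b.rev ∧ reflPerm a b i = a.rev) ∨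
      (i ≠ a ∧ i ≠ b ∧ i ≠ a.rev ∧ i ≠ b.rev ∧ reflPerm a b i = i) := by
  obtain ⟨h1, h2⟩ := h
  have h3 : a ≠ b.rev := fun e => h2 (by rw [e, Fin.rev_rev])
  have h4 : a.rev ≠ b.rev := fun e => h1 (Fin.rev_injective e).symm
  simp only [reflPerm, ha, hb, if_false, Equiv.Perm.mul_apply]
  by_cases e1 : i = a
  · subst e1
    simp [Equiv.swap_apply_of_ne_of_ne ha.symm h3]
  by_cases e2 : i = b
  · subst e2
    simp [Equiv.swap_apply_of_ne_of_ne h2 hb.symm]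
  by_cases e3 : i = a.rev
  · subst e3
    simp [Equiv.swap_apply_of_ne_of_ne h3.symm hb]
  by_cases e4 : i = b.rev
  · subst e4
    simp [Equiv.swap_apply_of_ne_of_ne ha h2.symm]
  · simp [e1, e2, e3, e4, Equiv.swap_apply_of_ne_of_ne]

theorem reflPerm_cases_middle {a b : Fin n} (hb : b.rev = b) (i : Fin n) :
    (i = a ∧ reflPerm a b i = a.rev) ∨ (i = a.rev ∧ reflPerm a b i = a) ∨
      (i ≠ a ∧ i ≠ a.rev ∧ reflPerm a b i = i) := by
  simp only [reflPerm, hb, if_true]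
  by_cases e1 : i = a
  · simp [e1]
  by_cases e3 : i = a.rev
  · simp [e3]
  · simp [e1, e3, Equiv.swap_apply_of_ne_of_ne]

theorem permElt_reflPerm_conj {σ : Equiv.Perm (Fin n)} (hσ : σ ∈ signedPerms n)
    (hσ' : permElt σ ∈ R.affWeyl) {i j : Fin n} (h : permElt (reflPerm i j) ∈ R.affWeyl) :
    permElt (reflPerm (σ i) (σ j)) ∈ R.affWeyl := by
  rw [← reflPerm_conj hσ, permElt_mul, permElt_mul, permElt_inv]
  exact mul_mem (mul_mem hσ' h) (inv_mem hσ')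

theorem permElt_mem_of_simple {i j : Fin n} (h : (i, j) ∈ R.simple) :
    permElt (reflPerm i j) ∈ R.affWeyl := by
  refine Subgroup.subset_closure ⟨i, j, 0, Or.inl ⟨h, rfl⟩, ?_⟩
  rw [affRefl, zero_smul, transl_zero, one_mul]

/-- Every root is, up to sign and duality, some `α_{i,j}` with `i < j < i*`. -/
theorem root_induction {P : Fin n → Fin n → Prop}
    (h : ∀ i j : Fin n, i < j → i.val + j.val + 1 < n → P i j)
    (hswap : ∀ i j, IsRootIndex i j → P i j → P j i)
    (hrev : ∀ i j, IsRootIndex i j → P i j → P j.rev i.rev)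
    {i j : Fin n} (hij : IsRootIndex i j) : P i j := by
  have key : ∀ i j : Fin n, IsRootIndex i j → i < j → P i j := by
    intro i j hij hlt
    have h2 := hij.2
    have hi := i.isLt
    have hj := j.isLt
    simp only [ne_eq, Fin.ext_iff, Fin.val_rev, Fin.lt_def] at h2 hlt
    by_cases hs : i.val + j.val + 1 < n
    · exact h i j hlt hs
    · have := hrev j.rev i.rev hij.symm.rev (h _ _ ?_ ?_)
      · simpa using this
      · simp only [Fin.lt_def, Fin.val_rev]
        omega
      · simp only [Fin.val_rev]
        omega
  rcases IsOrthogonal.lt_or_gt hij with hlt | hlt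
  · exact key i j hij hlt
  · exact hswap j i hij.symm (key j i hij.symm hlt)

theorem permElt_reflPerm_mem_of
    (h : ∀ i j : Fin n, i < j → i.val + j.val + 1 < n → permElt (reflPerm i j) ∈ R.affWeyl)
    {i j : Fin n} (hij : IsRootIndex i j) : permElt (reflPerm i j) ∈ R.affWeyl :=
  root_induction (P := fun i j => permElt (reflPerm i j) ∈ R.affWeyl) h
    (fun i j hij h => by rwa [reflPerm_swap hij]) (fun i j hij h => by rwa [reflPerm_rev hij]) hij

theorem lt_of_root {x : Fin n → ℝ} (hx : x ∈ apartment n)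
    (h : ∀ i j : Fin n, i < j → i.val + j.val + 1 < n → x i < x j)
    {i j : Fin n} (hij : IsRootIndex i j) (hlt : i < j) : x i < x j := by
  obtain ⟨c, hc⟩ := hx
  refine (root_induction (P := fun i j => (i < j → x i < x j) ∧ (j < i → x j < x i))
    (fun i j hlt hs => ⟨fun _ => h i j hlt hs, fun h' => absurd h' hlt.not_gt⟩)
    (fun i j _ h => ⟨h.2, h.1⟩) (fun i j _ h => ?_) hij).1 hlt
  have h1 := hc i
  have h2 := hc j
  simp only [Fin.rev_lt_rev]
  exact ⟨fun h' => by linarith [h.1 h'], fun h' => by linarith [h.2 h']⟩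

/-- By duality x_n - x_2 = x_{n-1} - x_1. As (1, n) is not a root index, every root difference is
dominated by one of these two, so the single affine wall bounds all of them. -/
theorem sub_mem_Ioo_of (h6 : 6 ≤ n) {x : Fin n → ℝ} (hx : x ∈ apartment n)
    (h : ∀ i j : Fin n, i < j → i.val + j.val + 1 < n → x i < x j)
    (hw : ∀ a b : Fin n, a.val + 1 = n → b.val = 1 → x a - x b < 1)
    {i j : Fin n} (hij : IsRootIndex i j) (hlt : i < j) : x i - x j ∈ Set.Ioo (-1 : ℝ) 0 := by
  have H : ∀ {i j : Fin n}, IsRootIndex i j → i < j → x i < x j := fun h1 h2 =>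
    lt_of_root hx h h1 h2
  refine ⟨?_, sub_neg.2 (H hij hlt)⟩
  obtain ⟨c, hc⟩ := hx
  let o : Fin n := ⟨0, by omega⟩
  let b : Fin n := ⟨1, by omega⟩
  let k : Fin n := ⟨2, by omega⟩
  have hbk : x b < x k := H (by
    constructor <;> simp only [ne_eq, Fin.ext_iff, Fin.val_rev, b, k] <;> omega)
    (by simp only [Fin.lt_def, b, k]; omega)
  have hkb : x k < x b.rev := H (by
    constructor <;> simp only [ne_eq, Fin.ext_iff, Fin.val_rev, b, k] <;> omega)
    (by simp only [Fin.lt_def, Fin.val_rev, b, k]; omega)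
  have w1 := hw o.rev b (by simp only [Fin.val_rev, o]; omega) rfl
  have w2 := hc o
  have w3 := hc b
  obtain ⟨n1, n2⟩ := hij
  simp only [ne_eq, Fin.ext_iff, Fin.val_rev, Fin.lt_def] at n1 n2 hlt
  by_cases hj : j = o.rev
  · have w4 : x j = x o.rev := by rw [hj]
    have : x b ≤ x i := by
      by_cases e1 : i = b
      · rw [e1]
      by_cases e2 : i = b.rev
      · rw [e2]
        linarith
      refine (H ⟨e1, e2⟩ ?_).le
      simp only [Fin.ext_iff, Fin.val_rev, Fin.lt_def, o, b] at *
      omega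
    linarith
  · have hi : x o ≤ x i := by
      by_cases e1 : i = o
      · rw [e1]
      refine (H ⟨e1, ?_⟩ ?_).le <;>
        simp only [ne_eq, Fin.ext_iff, Fin.val_rev, Fin.lt_def, o] at * <;> omega
    have hj' : x j ≤ x b.rev := by
      by_cases e1 : j = b
      · rw [e1]
        linarith
      by_cases e2 : j = b.rev
      · rw [e2]
      refine (H (i := j) (j := b.rev) ⟨Ne.symm e2, fun e => e1 (Fin.rev_injective e).symm⟩ ?_).le
      simp only [Fin.ext_iff, Fin.val_rev, Fin.lt_def, o, b] at *
      omega
    linarith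

theorem alcove_affine_wall {x : Fin n → ℝ} (hx : x ∈ R.alcove) (a b : Fin n) (ha : a.val + 1 = n)
    (hb : b.val = 1) : x a - x b < 1 := by
  exact_mod_cast hx.2 a b 1 (Or.inr ⟨ha, hb, rfl⟩)

theorem alcove_simple {x : Fin n → ℝ} (hx : x ∈ R.alcove) {a b : Fin n}
    (h : (a, b) ∈ R.simple) : x a < x b := by
  have := hx.2 a b 0 (Or.inl ⟨h, rfl⟩)
  push_cast at this
  linarith

/-- Propagation along the chain of simple roots `α_{i,i+1}`. -/
theorem chain_induction {P : Fin n → Fin n → Prop} {k : ℕ}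
    (h1 : ∀ i j : Fin n, i.val + 1 = j.val → j.val ≤ k → P i j)
    (h2 : ∀ i j l : Fin n, i < j → j.val + 1 = l.val → l.val ≤ k → P i j → P j l → P i l)
    {i j : Fin n} (hij : i < j) (hj : j.val ≤ k) : P i j := by
  obtain ⟨j, hjn⟩ := j
  induction j with
  | zero => exact absurd hij (Nat.not_lt_zero _)
  | succ j ih =>
    simp only [Fin.lt_def] at hij
    rcases Nat.lt_succ_iff_lt_or_eq.1 hij with h | h
    · exact h2 i ⟨j, by omega⟩ _ h rfl hj (ih (by omega) h (by simp only at hj ⊢; omega))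
        (h1 _ _ rfl hj)
    · exact h1 _ _ (by simp only; omega) hj

/-- The reflection s_{i,l} is the conjugate of s_{j,l} by s_{i,j}, so the chain of simple roots
generates all of these. -/
theorem permElt_chain {k : ℕ} (hk : 2 * k < n)
    (hs : ∀ i j : Fin n, i.val + 1 = j.val → j.val ≤ k → (i, j) ∈ R.simple)
    {i j : Fin n} (hij : i < j) (hj : j.val ≤ k) : permElt (reflPerm i j) ∈ R.affWeyl := by
  refine chain_induction (P := fun i j => permElt (reflPerm i j) ∈ R.affWeyl)
    (fun i j h1 h2 => permElt_mem_of_simple (hs i j h1 h2)) ?_ hij hj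
  intro i j l hij hl hlk h1 h2
  have r1 : IsRootIndex i j := by
    constructor <;> simp only [ne_eq, Fin.ext_iff, Fin.val_rev, Fin.lt_def] at * <;> omega
  have m1 : i.rev ≠ i := by
    simp only [ne_eq, Fin.ext_iff, Fin.val_rev, Fin.lt_def] at *
    omega
  have m2 : j.rev ≠ j := by
    simp only [ne_eq, Fin.ext_iff, Fin.val_rev, Fin.lt_def] at *
    omega
  have := permElt_reflPerm_conj (reflPerm_mem_signedPerms r1) h1 h2
  have e1 : reflPerm i j j = i := by
    rcases reflPerm_cases r1 m1 m2 j with h | h | h | h | h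
    · exact absurd h.1 r1.1
    · exact h.2
    · exact absurd h.1 r1.2
    · exact absurd h.1.symm m2
    · exact absurd rfl h.2.1
  have e2 : reflPerm i j l = l := by
    rcases reflPerm_cases r1 m1 m2 l with h | h | h | h | h
    case inr.inr.inr.inr => exact h.2.2.2.2
    all_goals
      have := h.1
      simp only [Fin.ext_iff, Fin.val_rev, Fin.lt_def] at *
      omega
  rwa [e1, e2] at this

theorem eq_of_reflPerm_lt {a b : Fin n} (hab : a.val + 1 = b.val) (hb : 2 * b.val + 1 < n)
    {i j : Fin n} (hij : IsRootIndex i j) (hlt : i < j) (h : reflPerm a b j < reflPerm a b i) :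
    (i, j) = (a, b) ∨ (i, j) = (b.rev, a.rev) := by
  have r : IsRootIndex a b := by
    constructor <;> simp only [ne_eq, Fin.ext_iff, Fin.val_rev] <;> omega
  have m1 : a.rev ≠ a := by
    simp only [ne_eq, Fin.ext_iff, Fin.val_rev]
    omega
  have m2 : b.rev ≠ b := by
    simp only [ne_eq, Fin.ext_iff, Fin.val_rev]
    omega
  have pi := reflPerm_cases r m1 m2 i
  have pj := reflPerm_cases r m1 m2 j
  obtain ⟨h1, h2⟩ := hij
  generalize reflPerm a b i = i' at *
  generalize reflPerm a b j = j' at *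
  simp only [Prod.mk.injEq, ne_eq, Fin.ext_iff, Fin.val_rev, Fin.lt_def] at *
  rcases pi with pi | pi | pi | pi | pi <;> rcases pj with pj | pj | pj | pj | pj <;> omega

theorem eq_of_reflPerm_lt_fork {a b : Fin n} (hab : a.val + 2 = b.val) (hb : 2 * b.val = n)
    {i j : Fin n} (hij : IsRootIndex i j) (hlt : i < j) (h : reflPerm a b j < reflPerm a b i) :
    (i, j) = (a, b) ∨ (i, j) = (b.rev, a.rev) := by
  have r : IsRootIndex a b := by
    constructor <;> simp only [ne_eq, Fin.ext_iff, Fin.val_rev] <;> omega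
  have m1 : a.rev ≠ a := by
    simp only [ne_eq, Fin.ext_iff, Fin.val_rev]
    omega
  have m2 : b.rev ≠ b := by
    simp only [ne_eq, Fin.ext_iff, Fin.val_rev]
    omega
  have pi := reflPerm_cases r m1 m2 i
  have pj := reflPerm_cases r m1 m2 j
  obtain ⟨h1, h2⟩ := hij
  generalize reflPerm a b i = i' at *
  generalize reflPerm a b j = j' at *
  simp only [Prod.mk.injEq, ne_eq, Fin.ext_iff, Fin.val_rev, Fin.lt_def] at *
  rcases pi with pi | pi | pi | pi | pi <;> rcases pj with pj | pj | pj | pj | pj <;> omega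

theorem eq_of_reflPerm_lt_middle {a b : Fin n} (hab : a.val + 1 = b.val) (hb : 2 * b.val + 1 = n)
    {i j : Fin n} (hij : IsRootIndex i j) (hlt : i < j) (h : reflPerm a b j < reflPerm a b i) :
    (i, j) = (a, b) ∨ (i, j) = (b.rev, a.rev) := by
  have m2 : b.rev = b := by
    simp only [Fin.ext_iff, Fin.val_rev]
    omega
  have pi := reflPerm_cases_middle (a := a) m2 i
  have pj := reflPerm_cases_middle (a := a) m2 j
  obtain ⟨h1, h2⟩ := hij
  generalize reflPerm a b i = i' at *
  generalize reflPerm a b j = j' at *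
  simp only [Prod.mk.injEq, ne_eq, Fin.ext_iff, Fin.val_rev, Fin.lt_def] at *
  rcases pi with pi | pi | pi <;> rcases pj with pj | pj | pj <;> omega

theorem rev_ne_self_of_even {m : ℕ} (i : Fin (2 * m)) : i.rev ≠ i := by
  simp only [ne_eq, Fin.ext_iff, Fin.val_rev]
  omega

theorem isOrthogonal_dataD {m : ℕ} (hm : 3 ≤ m) : (dataD m).IsOrthogonal where
  six_le := by omega
  weyl_le := inf_le_left
  reflPerm_mem i j h := by
    refine ⟨reflPerm_mem_signedPerms h, ?_⟩
    change Equiv.Perm.sign (reflPerm i j) = 1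
    rw [reflPerm, if_neg (rev_ne_self_of_even j),
      if_neg (rev_ne_self_of_even i), map_mul, Equiv.Perm.sign_swap h.1.symm,
      Equiv.Perm.sign_swap h.rev.1.symm]
    rfl
  isRootIndex_of_simple := by
    rintro ⟨i, j⟩ h
    simp only [dataD, Set.mem_ofPred_eq] at h
    refine ⟨⟨?_, ?_⟩, ?_⟩ <;> simp only [ne_eq, Fin.ext_iff, Fin.val_rev, Fin.lt_def] <;> omega
  sub_mem_Ioo x hx i j := by
    refine sub_mem_Ioo_of (by omega) hx.1 ?_ (alcove_affine_wall hx)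
    obtain ⟨c, hc⟩ := hx.1
    have chain : ∀ i j : Fin (2 * m), i < j → j.val ≤ m - 1 → x i < x j := fun i j h1 h2 =>
      chain_induction (P := fun i j => x i < x j)
        (fun i j h1 h2 => alcove_simple hx (Or.inl ⟨h1, by simp only; omega⟩))
        (fun i j l _ _ _ h1 h2 => h1.trans h2) h1 h2
    have fork : ∀ i j : Fin (2 * m), i.val + 2 ≤ m → j.val = m → x i < x j := by
      intro i j h1 h2
      have h3 : x ⟨m - 2, by omega⟩ < x j :=
        alcove_simple hx (Or.inr ⟨by simp only; omega, h2⟩)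
      rcases h1.lt_or_eq with h | h
      · exact (chain i ⟨m - 2, by omega⟩ (by simp only [Fin.lt_def]; omega)
          (by simp only; omega)).trans h3
      · rwa [show i = ⟨m - 2, by omega⟩ from Fin.ext (by simp only; omega)]
    intro i j h1 h2
    rw [Fin.lt_def] at h1
    by_cases hj : j.val ≤ m - 1
    · exact chain i j h1 hj
    · have h3 := fork i ⟨m, by omega⟩ (by omega) rfl
      have h4 : x j.rev ≤ x ⟨m - 1, by omega⟩ := by
        by_cases h : j.rev = ⟨m - 1, by omega⟩
        · rw [h]
        · simp only [Fin.ext_iff, Fin.val_rev] at h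
          refine (chain _ _ ?_ ?_).le
          · simp only [Fin.lt_def, Fin.val_rev]
            omega
          · exact le_rfl
      have h5 := hc j
      have h6 := hc ⟨m, by omega⟩
      rw [show (⟨m, by omega⟩ : Fin (2 * m)).rev = ⟨m - 1, by omega⟩ from
        Fin.ext (by simp only [Fin.val_rev]; omega)] at h6
      linarith
  eq_of_lt := by
    rintro ⟨a, b⟩ hp i j hij hlt h
    rcases hp with ⟨h1, h2⟩ | ⟨h1, h2⟩ <;> simp only at h1 h2
    · exact eq_of_reflPerm_lt h1 (by omega) hij hlt h
    · exact eq_of_reflPerm_lt_fork (by omega) (by omega) hij hlt h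
  permElt_mem i j hij := by
    have chain : ∀ i j : Fin (2 * m), i < j → j.val ≤ m - 1 →
        permElt (reflPerm i j) ∈ (dataD m).affWeyl := fun i j h1 h2 =>
      permElt_chain (R := dataD m) (k := m - 1) (by omega)
        (fun i j h1 h2 => Or.inl ⟨h1, by simp only; omega⟩) h1 h2
    obtain ⟨p, hp⟩ : ∃ p : Fin (2 * m), p.val = m - 2 := ⟨⟨m - 2, by omega⟩, rfl⟩
    obtain ⟨p', hp'⟩ : ∃ p : Fin (2 * m), p.val = m - 1 := ⟨⟨m - 1, by omega⟩, rfl⟩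
    obtain ⟨k, hk⟩ : ∃ p : Fin (2 * m), p.val = m := ⟨⟨m, by omega⟩, rfl⟩
    have fork : ∀ i j : Fin (2 * m), i.val + 2 ≤ m → j.val = m →
        permElt (reflPerm i j) ∈ (dataD m).affWeyl := by
      intro i j h1 h2
      have h3 : permElt (reflPerm p j) ∈ (dataD m).affWeyl :=
        permElt_mem_of_simple (Or.inr ⟨by simp only; omega, h2⟩)
      rcases h1.lt_or_eq with h | h
      · have h4 := chain i p (by simp only [Fin.lt_def]; omega)
          (by omega)
        have r : IsRootIndex i p := by
          constructor <;> simp only [ne_eq, Fin.ext_iff, Fin.val_rev] <;> omega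
        have h5 := permElt_reflPerm_conj (reflPerm_mem_signedPerms r) h4 h3
        have e1 : reflPerm i p p = i := by
          have := reflPerm_cases r (rev_ne_self_of_even _) (rev_ne_self_of_even _)
            p
          simp only [ne_eq, Fin.ext_iff, Fin.val_rev, true_and,
            not_true_eq_false, false_and, and_false, or_false] at this ⊢
          omega
        have e2 : reflPerm i p j = j := by
          have := reflPerm_cases r (rev_ne_self_of_even _) (rev_ne_self_of_even _) j
          simp only [ne_eq, Fin.ext_iff, Fin.val_rev] at this ⊢
          omega
        rwa [e1, e2] at h5
      · rwa [show i = p from Fin.ext (by omega)]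
    refine permElt_reflPerm_mem_of (fun i j h1 h2 => ?_) hij
    rw [Fin.lt_def] at h1
    by_cases hj : j.val ≤ m - 1
    · exact chain i j h1 hj
    · have h3 := fork i k (by omega) hk
      by_cases hjm : j.val = m
      · rwa [show j = k from Fin.ext (by omega)]
      · have h4 := chain j.rev p' (by simp only [Fin.lt_def, Fin.val_rev]; omega)
          (by omega)
        have r : IsRootIndex j.rev p' := by
          constructor <;> simp only [ne_eq, Fin.ext_iff, Fin.val_rev] <;> omega
        have h5 := permElt_reflPerm_conj (reflPerm_mem_signedPerms r) h4 h3
        have e1 : reflPerm j.rev p' i = i := by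
          have := reflPerm_cases r (rev_ne_self_of_even _) (rev_ne_self_of_even _) i
          simp only [ne_eq, Fin.ext_iff, Fin.val_rev] at this ⊢
          omega
        have e2 : reflPerm j.rev p' k = j := by
          have := reflPerm_cases r (rev_ne_self_of_even _) (rev_ne_self_of_even _) k
          simp only [ne_eq, Fin.ext_iff, Fin.val_rev] at this ⊢
          omega
        rwa [e1, e2] at h5

theorem isOrthogonal_dataB {m : ℕ} (hm : 3 ≤ m) : (dataB m).IsOrthogonal where
  six_le := by omega
  weyl_le := le_rfl
  reflPerm_mem i j h := reflPerm_mem_signedPerms h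
  isRootIndex_of_simple := by
    rintro ⟨i, j⟩ h
    simp only [dataB, Set.mem_ofPred_eq] at h
    refine ⟨⟨?_, ?_⟩, ?_⟩ <;> simp only [ne_eq, Fin.ext_iff, Fin.val_rev, Fin.lt_def] <;> omega
  sub_mem_Ioo x hx i j := by
    refine sub_mem_Ioo_of (by omega) hx.1 ?_ (alcove_affine_wall hx)
    obtain ⟨c, hc⟩ := hx.1
    have chain : ∀ i j : Fin (2 * m + 1), i < j → j.val ≤ m → x i < x j := fun i j h1 h2 =>
      chain_induction (P := fun i j => x i < x j)
        (fun i j h1 h2 => alcove_simple hx ⟨h1, h2⟩)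
        (fun i j l _ _ _ h1 h2 => h1.trans h2) h1 h2
    intro i j h1 h2
    rw [Fin.lt_def] at h1
    by_cases hj : j.val ≤ m
    · exact chain i j h1 hj
    · have h3 := chain i ⟨m, by omega⟩ (by simp only [Fin.lt_def]; omega) le_rfl
      have h4 := chain j.rev ⟨m, by omega⟩ (by simp only [Fin.lt_def, Fin.val_rev]; omega) le_rfl
      have h5 := hc j
      have h6 := hc ⟨m, by omega⟩
      rw [show (⟨m, by omega⟩ : Fin (2 * m + 1)).rev = ⟨m, by omega⟩ from
        Fin.ext (by simp only [Fin.val_rev]; omega)] at h6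
      linarith
  eq_of_lt := by
    rintro ⟨a, b⟩ ⟨h1, h2⟩ i j hij hlt h
    simp only at h1 h2
    rcases h2.lt_or_eq with h3 | h3
    · exact eq_of_reflPerm_lt h1 (by omega) hij hlt h
    · exact eq_of_reflPerm_lt_middle h1 (by omega) hij hlt h
  permElt_mem i j hij := by
    have chain : ∀ i j : Fin (2 * m + 1), i < j → j.val ≤ m →
        permElt (reflPerm i j) ∈ (dataB m).affWeyl := fun i j h1 h2 =>
      permElt_chain (R := dataB m) (k := m) (by omega) (fun i j h1 h2 => ⟨h1, h2⟩) h1 h2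
    obtain ⟨k, hk⟩ : ∃ p : Fin (2 * m + 1), p.val = m := ⟨⟨m, by omega⟩, rfl⟩
    refine permElt_reflPerm_mem_of (fun i j h1 h2 => ?_) hij
    rw [Fin.lt_def] at h1
    by_cases hj : j.val ≤ m
    · exact chain i j h1 hj
    · have h3 := chain i j.rev (by simp only [Fin.lt_def, Fin.val_rev]; omega)
        (by simp only [Fin.val_rev]; omega)
      have h4 := chain j.rev k (by simp only [Fin.lt_def, Fin.val_rev]; omega)
        (by omega)
      have r : IsRootIndex j.rev k := by
        constructor <;> simp only [ne_eq, Fin.ext_iff, Fin.val_rev] <;> omega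
      have hmid : k.rev = k :=
        Fin.ext (by rw [Fin.val_rev]; omega)
      -- For the middle index `k` the reflection s_{j*,k} just exchanges j* and j, so it conjugates
      -- s_{i,j*} to s_{i,j}.
      have h5 := permElt_reflPerm_conj (reflPerm_mem_signedPerms r) h4 h3
      have e1 : reflPerm j.rev k i = i := by
        have := reflPerm_cases_middle (a := j.rev) hmid i
        simp only [ne_eq, Fin.ext_iff, Fin.val_rev] at this ⊢
        omega
      have e2 : reflPerm j.rev k j.rev = j := by
        have := reflPerm_cases_middle (a := j.rev) hmid j.rev
        simp only [ne_eq, Fin.ext_iff, Fin.val_rev, true_and,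
          not_true_eq_false, false_and, or_false] at this ⊢
        omega
      rwa [e1, e2] at h5

theorem flip_mem_orbit_dataB {m : ℕ} {μ v : Fin (2 * m + 1) → ℤ} (hv : v ∈ (dataB m).orbit μ)
    (i : Fin (2 * m + 1)) : (fun j => v (Equiv.swap i i.rev j)) ∈ (dataB m).orbit μ :=
  comp_mem_orbit hv (swap_rev_mem_signedPerms i)

/-- A single flip is odd, hence outside the Weyl group. A vector of the orbit has a pair c, c* with
equal entries; flipping it as well changes nothing and makes the permutation even. -/
theorem flip_mem_orbit_dataD {m : ℕ} (hm : 3 ≤ m) {μ v : Fin (2 * m) → ℤ} {k : Fin (2 * m)}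
    (hk : μ k.rev = μ k) (hv : v ∈ (dataD m).orbit μ) (i : Fin (2 * m)) :
    (fun j => v (Equiv.swap i i.rev j)) ∈ (dataD m).orbit μ := by
  have hR := isOrthogonal_dataD hm
  obtain ⟨c, hc⟩ : ∃ c, v c.rev = v c := by
    obtain ⟨σ, hσ, rfl⟩ := hv
    have hs : σ⁻¹ (σ k).rev = k.rev := by
      rw [← hR.weyl_le hσ k]
      exact σ.symm_apply_apply _
    refine ⟨σ k, ?_⟩
    change μ (σ⁻¹ (σ k).rev) = μ (σ⁻¹ (σ k))
    rw [hs, hk]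
    exact congrArg μ (σ.symm_apply_apply k).symm
  have swap_eq : ∀ d, v d.rev = v d → ∀ j, v (Equiv.swap d d.rev j) = v j := by
    intro d hd j
    rw [Equiv.swap_apply_def]
    split_ifs with h1 h2
    · rw [h1, hd]
    · rw [h2, hd]
    · rfl
  by_cases h : IsRootIndex i c
  · have h1 := comp_mem_orbit hv (mul_mem (hR.reflPerm_mem _ _ h.symm)
      (hR.reflPerm_mem _ _ h.symm.rev_right))
    rw [← IsOrthogonal.flipPerm_eq h.symm (rev_ne_self_of_even _) (rev_ne_self_of_even _)] at h1
    convert h1 using 2 with j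
    rw [Equiv.Perm.mul_apply, swap_eq c hc]
  · have h1 : v i.rev = v i := by
      by_cases e : c = i
      · rw [← e, hc]
      · have e' : c = i.rev := by
          by_contra e'
          exact h ⟨e, e'⟩
        rw [e', Fin.rev_rev] at hc
        exact hc.symm
    simpa only [swap_eq i h1] using hv

end WeylData

namespace WeylData

variable {n : ℕ} {R : WeylData n}

theorem IsOrthogonal.adm_ssubset_perm (hR : R.IsOrthogonal) {q : ℕ} (h3 : 3 ≤ q) (hq : 2 * q < n)
    (hflip : ∀ v ∈ R.orbit (muVec n q), ∀ i, (fun j => v (Equiv.swap i i.rev j)) ∈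
      R.orbit (muVec n q)) : R.Adm (muVec n q) ⊂ R.Perm (muVec n q) := by
  let a : Fin n := ⟨q - 2, by omega⟩
  let b : Fin n := ⟨q - 1, by omega⟩
  exact ⟨hR.adm_subset_perm (muVec_add_rev hq), fun h =>
    hR.flipElt_notMem_adm h3 hq (a := a) (b := b) rfl rfl
      (h (hR.flipElt_mem_perm h3 hq rfl rfl hflip))⟩

theorem flip_mem_orbit_muVec_dataD {m q : ℕ} (hm : 3 ≤ m) (hq : q < m) :
    ∀ v ∈ (dataD m).orbit (muVec (2 * m) q), ∀ i,
      (fun j => v (Equiv.swap i i.rev j)) ∈ (dataD m).orbit (muVec (2 * m) q) := by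
  intro v hv i
  -- Counting from 0, position q and its dual both carry the entry 1, because q < m.
  refine flip_mem_orbit_dataD hm (k := ⟨q, by omega⟩) ?_ hv i
  simp only [muVec, Fin.val_rev]
  split_ifs <;> omega

theorem adm_ssubset_perm_dataD {m q : ℕ} (h3 : 3 ≤ q) (hq : q < m) :
    (dataD m).Adm (muVec (2 * m) q) ⊂ (dataD m).Perm (muVec (2 * m) q) :=
  (isOrthogonal_dataD (by omega)).adm_ssubset_perm h3 (by omega)
    (flip_mem_orbit_muVec_dataD (by omega) hq)

theorem adm_ssubset_perm_dataB {m q : ℕ} (h3 : 3 ≤ q) (hq : q ≤ m) :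
    (dataB m).Adm (muVec (2 * m + 1) q) ⊂ (dataB m).Perm (muVec (2 * m + 1) q) :=
  (isOrthogonal_dataB (by omega)).adm_ssubset_perm h3 (by omega)
    fun _ hv i => flip_mem_orbit_dataB hv i

end WeylData

/-! ### The explicit elements, the embedding, and the rank of B_3 -/

theorem exampleD4_eq : exampleD4 = flipElt (2 * 4) 3 1 2 := by
  have h : (![2, 1, 1, 1, 1, 1, 1, 0] : Fin (2 * 4) → ℤ) = muVec (2 * 4) (3 - 2) := by
    decide
  rw [exampleD4, h]
  rfl

theorem exampleB3_eq : exampleB3 = flipElt (2 * 3 + 1) 3 1 2 := by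
  have h : (![2, 1, 1, 1, 1, 1, 0] : Fin (2 * 3 + 1) → ℤ) = muVec (2 * 3 + 1) (3 - 2) := by
    decide
  rw [exampleB3, h]
  rfl

theorem embedBD_muVec : embedBD 3 (muVec (2 * 3 + 1) 3) = muVec (2 * 4) 3 := by
  decide

theorem affAct_exampleD4_embedBD (x : Fin (2 * 3 + 1) → ℝ) :
    affAct exampleD4 (embedBD 3 x) = embedBD 3 (affAct exampleB3 x) := by
  have h1 : ∀ j : Fin (2 * 4), translPart exampleD4 j = embedBD 3 (translPart exampleB3) j := by
    decide
  have h2 : ∀ j : Fin (2 * 4), embedBD 3 id (exampleD4.right⁻¹ j) =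
      embedBD 3 (fun k => exampleB3.right⁻¹ k) j := by
    decide
  have h3 : ∀ j, embedBD 3 x j = x (embedBD 3 id j) := fun j => by
    unfold embedBD
    split_ifs <;> rfl
  funext j
  have h4 : embedBD 3 (affAct exampleB3 x) j =
      embedBD 3 (translPart exampleB3) j + x (embedBD 3 (fun k => exampleB3.right⁻¹ k) j) := by
    simp only [embedBD]
    split_ifs <;> rfl
  rw [h4, affAct, h1, h3, h2]

theorem mem_corootLattice_antisymm {n : ℕ} {v : Fin n → ℤ} (hv : v ∈ corootLattice n)
    (j : Fin n) : v j + v j.rev = 0 := by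
  induction hv using Submodule.span_induction generalizing j with
  | mem v hv =>
    obtain ⟨a, b, h, rfl⟩ := hv
    have key : ∀ (c : Fin n) (z : ℤ),
        (Pi.single c z : Fin n → ℤ) j.rev = (Pi.single c.rev z : Fin n → ℤ) j := by
      intro c z
      have : j.rev = c ↔ j = c.rev := ⟨fun e => by rw [← e, Fin.rev_rev], fun e => by
        rw [e, Fin.rev_rev]⟩
      simp only [Pi.single_apply, this]
    unfold corootVec
    split_ifs <;> simp only [Pi.add_apply, Pi.sub_apply, key, Fin.rev_rev] <;> ring
  | zero => simp
  | add u v _ _ hu hv =>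
    have := hu j
    have := hv j
    simp only [Pi.add_apply]
    linarith
  | smul c v _ hv =>
    have := hv j
    simp only [Pi.smul_apply, smul_eq_mul]
    rw [← mul_add, this, mul_zero]

/-- Antisymmetry lets the first three coordinates determine a vector of the lattice, and the three
simple coroots are independent. -/
theorem finrank_corootLattice_seven : Module.finrank ℤ (corootLattice (2 * 3 + 1)) = 3 := by
  apply le_antisymm
  · let f : corootLattice (2 * 3 + 1) →ₗ[ℤ] (Fin 3 → ℤ) :=
      (LinearMap.funLeft ℤ ℤ (Fin.castLE (by norm_num) : Fin 3 → Fin (2 * 3 + 1))).comp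
        (corootLattice (2 * 3 + 1)).subtype
    have hf : Function.Injective f := by
      rw [injective_iff_map_eq_zero]
      rintro ⟨v, hv⟩ h
      have ha := mem_corootLattice_antisymm hv
      have h0 : v 0 = 0 := congrFun h 0
      have h1 : v 1 = 0 := congrFun h 1
      have h2 : v 2 = 0 := congrFun h 2
      have a0 : v 0 + v 6 = 0 := ha 0
      have a1 : v 1 + v 5 = 0 := ha 1
      have a2 : v 2 + v 4 = 0 := ha 2
      have a3 : v 3 + v 3 = 0 := ha 3
      rw [Subtype.ext_iff]
      funext j
      change v j = 0
      fin_cases j <;> simp only [Fin.zero_eta, Fin.mk_one, Fin.reduceFinMk] <;> omega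
    simpa using LinearMap.finrank_le_finrank_of_injective hf
  · have hroot : ∀ i j : Fin (2 * 3 + 1), IsRootIndex i j →
        corootVec i j ∈ corootLattice (2 * 3 + 1) :=
      fun i j h => Submodule.subset_span ⟨i, j, h, rfl⟩
    let b : Fin 3 → corootLattice (2 * 3 + 1) :=
      ![⟨corootVec 0 1, hroot 0 1 (by decide)⟩, ⟨corootVec 1 2, hroot 1 2 (by decide)⟩,
        ⟨corootVec 2 3, hroot 2 3 (by decide)⟩]
    have hb : LinearIndependent ℤ b := by
      rw [Fintype.linearIndependent_iff]
      intro g hg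
      have hg' : ∀ k : Fin (2 * 3 + 1),
          g 0 * corootVec 0 1 k + g 1 * corootVec 1 2 k + g 2 * corootVec 2 3 k = 0 := by
        intro k
        have := congrFun (congrArg Subtype.val hg) k
        simpa [Fin.sum_univ_three, b] using this
      have g0 := hg' 0
      have g1 := hg' 1
      have g2 := hg' 2
      rw [show corootVec (0 : Fin (2 * 3 + 1)) 1 0 = 1 by decide,
        show corootVec (1 : Fin (2 * 3 + 1)) 2 0 = 0 by decide,
        show corootVec (2 : Fin (2 * 3 + 1)) 3 0 = 0 by decide] at g0
      rw [show corootVec (0 : Fin (2 * 3 + 1)) 1 1 = -1 by decide,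
        show corootVec (1 : Fin (2 * 3 + 1)) 2 1 = 1 by decide,
        show corootVec (2 : Fin (2 * 3 + 1)) 3 1 = 0 by decide] at g1
      rw [show corootVec (0 : Fin (2 * 3 + 1)) 1 2 = 0 by decide,
        show corootVec (1 : Fin (2 * 3 + 1)) 2 2 = -1 by decide,
        show corootVec (2 : Fin (2 * 3 + 1)) 3 2 = 2 by decide] at g2
      intro i
      fin_cases i <;> simp only [Fin.zero_eta, Fin.mk_one, Fin.reduceFinMk] <;> omega
    simpa using hb.fintype_card_le_finrank

/-! ### The two minuscule cocharacters and the main theorem -/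

theorem spinCochar_mem_cocharGroup (m : ℕ) : spinCochar m ∈ cocharGroup (2 * m) := by
  refine ⟨1, fun j => ?_⟩
  simp only [spinCochar, Fin.val_rev]
  split_ifs <;> omega

theorem spinCochar'_mem_cocharGroup {m : ℕ} (hm : 1 ≤ m) : spinCochar' m ∈ cocharGroup (2 * m) := by
  refine ⟨1, fun j => ?_⟩
  simp only [spinCochar', Fin.val_rev]
  split_ifs <;> omega

theorem muVec_eq_spinCochar_add {m : ℕ} (hm : 1 ≤ m) :
    muVec (2 * m) (m - 1) = spinCochar m + spinCochar' m := by
  funext j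
  simp only [muVec, spinCochar, spinCochar', Pi.add_apply]
  split_ifs <;> omega

theorem mainTheorem8 :
    -- type `D_m`, `m ≥ 4`, `3 ≤ q < m`
    (∀ m q : ℕ, 4 ≤ m → 3 ≤ q → q < m →
      (dataD m).Adm (muVec (2 * m) q) ⊂ (dataD m).Perm (muVec (2 * m) q)) ∧
    -- the explicit element for `m = 4`, `q = 3`
    (exampleD4 ∈ (dataD 4).Perm (muVec (2 * 4) 3) ∧
      exampleD4 ∉ (dataD 4).Adm (muVec (2 * 4) 3)) ∧
    -- sums of two dominant minuscule cocharacters in type `D_m`, `m ≥ 4`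
    (∀ m : ℕ, 4 ≤ m →
      (dataD m).IsDominant (spinCochar m) ∧ IsMinusculeCochar (spinCochar m) ∧
      (dataD m).IsDominant (spinCochar' m) ∧ IsMinusculeCochar (spinCochar' m) ∧
      muVec (2 * m) (m - 1) = spinCochar m + spinCochar' m ∧
      (dataD m).Adm (spinCochar m + spinCochar' m) ≠
        (dataD m).Perm (spinCochar m + spinCochar' m)) ∧
    -- type `B_m`, `m ≥ 3`, `3 ≤ q ≤ m`
    (∀ m q : ℕ, 3 ≤ m → 3 ≤ q → q ≤ m →
      (dataB m).Adm (muVec (2 * m + 1) q) ⊂ (dataB m).Perm (muVec (2 * m + 1) q)) ∧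
    -- the explicit element of type `B_3`, which corresponds to the one of type `D_4`,
    -- and the rank of the root system
    (exampleB3 ∈ (dataB 3).Perm (muVec (2 * 3 + 1) 3) ∧
      exampleB3 ∉ (dataB 3).Adm (muVec (2 * 3 + 1) 3) ∧
      embedBD 3 (muVec (2 * 3 + 1) 3) = muVec (2 * 4) 3 ∧
      (∀ x : Fin (2 * 3 + 1) → ℝ,
        affAct exampleD4 (embedBD 3 x) = embedBD 3 (affAct exampleB3 x)) ∧
      Module.finrank ℤ (corootLattice (2 * 3 + 1)) = 3) := by
  have hD := fun m (hm : 3 ≤ m) => WeylData.isOrthogonal_dataD hm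
  have hB := fun m (hm : 3 ≤ m) => WeylData.isOrthogonal_dataB hm
  refine ⟨fun m q _ h3 hq => WeylData.adm_ssubset_perm_dataD h3 hq, ⟨?_, ?_⟩, fun m hm => ?_,
    fun m q _ h3 hq => WeylData.adm_ssubset_perm_dataB h3 hq, ?_, ?_, embedBD_muVec,
    affAct_exampleD4_embedBD, finrank_corootLattice_seven⟩
  · rw [exampleD4_eq]
    exact (hD 4 (by norm_num)).flipElt_mem_perm le_rfl (by norm_num) rfl rfl
      (WeylData.flip_mem_orbit_muVec_dataD (by norm_num) (by norm_num))
  · rw [exampleD4_eq]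
    exact (hD 4 (by norm_num)).flipElt_notMem_adm le_rfl (by norm_num) rfl rfl
  · refine ⟨⟨spinCochar_mem_cocharGroup m, fun i j h => ?_⟩,
      ⟨spinCochar_mem_cocharGroup m, fun i j _ => ?_⟩,
      ⟨spinCochar'_mem_cocharGroup (by omega), fun i j h => ?_⟩,
      ⟨spinCochar'_mem_cocharGroup (by omega), fun i j _ => ?_⟩,
      muVec_eq_spinCochar_add (by omega), ?_⟩
    · simp only [dataD, Set.mem_ofPred_eq] at h
      simp only [spinCochar]
      split_ifs <;> omega
    · simp only [spinCochar]
      split_ifs <;> simp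
    · simp only [dataD, Set.mem_ofPred_eq] at h
      simp only [spinCochar']
      split_ifs <;> omega
    · simp only [spinCochar']
      split_ifs <;> simp
    · rw [← muVec_eq_spinCochar_add (by omega)]
      exact (WeylData.adm_ssubset_perm_dataD (by omega) (by omega)).ne
  · rw [exampleB3_eq]
    exact (hB 3 le_rfl).flipElt_mem_perm le_rfl (by norm_num) rfl rfl
      fun _ hv i => WeylData.flip_mem_orbit_dataB hv i
  · rw [exampleB3_eq]
    exact (hB 3 le_rfl).flipElt_notMem_adm le_rfl (by norm_num) rfl rfl
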